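/- \textbf{Setting.} Let $N\ge 2$, let $\mathcal X$ be a tensor of dimensions $I_1\times\cdots\times I_N$, $I=\prod_k I_k$, fix a mode $n$, and let $A^{(k)}$ ($k\ne n$) be $I_k\times R$ matrices. MTTKRP computes the $I_n\times R$ matrix $B(i_n,r)=\sum \mathcal X(i)\prod_{k\ne n}A^{(k)}(i_k,r)$, the sum being over all $i$ with $n$-th entry $i_n$. A parallel MTTKRP algorithm on $P$ processors is a straight-line program in which each processor evaluates the products, each as one atomic multiply, and adds sums of products, using values in its own local memory (of unrestricted capacity, with accumulators that are initially empty), and in which values are sent from one processor to another one at a time. Initially each processor owns some of the input entries and finally some of the output entries; every output entry is finally owned by some processor. The algorithm is $(\gamma,\delta)$-balanced if each processor initially owns at most $\gamma I/P$ tensor entries, and the number of input matrix entries that it initially owns plus the number of output entries that it finally owns is at most $\delta\sum_k I_kR/P$. The cost of an algorithm is the largest number of sends plus receives of any processor. The parallel general algorithm uses a processor grid $P=P_0P_1\cdots P_N$ of positive integers. Each $[I_k]$ is partitioned into $P_k$ parts $S^{(k)}_{p}$ and $[R]$ into $P_0$ parts $T_{p}$ (parts may be empty). Processor $p=(p_0,\dots,p_N)$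 initially owns a part $\mathcal X_p$ of a partition of $\mathcal X(S^{(1)}_{p_1},\dots,S^{(N)}_{p_N})$ among the processors with the same $(p_1,\dots,p_N)$, and for $k\neq n$ a part $A^{(k)}_p$ of a partition of $A^{(k)}(S^{(k)}_{p_k},T_{p_0})$ among the processors with the same $(p_0,p_k)$; it finally owns a part $B_p$ of a partition of $B(S^{(n)}_{p_n},T_{p_0})$ among those with the same $(p_0,p_n)$. The algorithm All-Gathers the subtensors and the blocks of each $A^{(k)}$ over these sets of processors, performs a local MTTKRP on each processor, and Reduce-Scatters the contributions to $B$, with bucket collectives (a ring of $q$ processors, $q-1$ steps, each processor passing one block to its left neighbour in each step). The distribution is called even if $|\mathcal X_p|\le\lceil\prod_k\lceil I_k/P_k\rceil/P_0\rceil$, and $|A^{(k)}_p|$ for $k\ne n$ and $|B_p|$ for $k=n$ are at most $\lceil\lceil I_k/P_k\rceil\lceil R/P_0\rceil/(P/(P_kP_0))\rceil$, for all $p$. \textbf{Theorem.} Let $\alpha,\beta>1$, $\gamma>\alpha$, $\delta>\alpha^{1/N}\beta$, and suppose that for all $k$ $$P_k\le(\alpha^{1/N}-1)I_k,\quad P\le(\gamma-\alpha)I,\quad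 P_0\le(\beta-1)R,\quad P\le(\delta-\alpha^{1/N}\beta)I_kR .$$ (1) For all $\varepsilon,\eta>0$ there is a constant $C>0$, depending only on $\varepsilon,\eta$, such that the following holds. Suppose $NR\le(I/P)^{1-1/N}$, $P_0=1$, $I_k/P_k\le(\varepsilon/\delta)(I/P)^{1/N}$ for all $k$, $\eta<c$ with $c=(2/(3\gamma))^{1-1/N}$, and $$P\ge\Big(\frac{\delta}{c-\eta}\,\frac{\sum_k I_k}{N I^{1/N}}\Big)^{N/(N-1)} .$$ Then even distributions on the grid exist, and with every even distribution the parallel general algorithm is a $(\gamma,\delta)$-balanced parallel MTTKRP algorithm whose cost is at most $$C\cdot\min\Big\{c\,NR\,(I/P)^{1/N}-\delta\sum_k\frac{I_kR}{P},\ \frac{\gamma I}{2P}\Big\}$$ and at most $C$ times the cost of any $(\gamma,\delta)$-balanced parallel MTTKRP algorithm on $P$ processors for the same problem. (2) For all $\mu,\nu,\tau>0$ there is a constant $C>0$, depending only on $\mu,\nu,\tau$, such that the following holds. Suppose $NR>(I/P)^{1-1/N}$, $\tau<2-\gamma$, $$\frac{\delta}{\nu}\Big(\frac{(NR)^{N-1}}{(I/P)^N}\Big)^{\frac1{2N-1}}\frac{I_k}{P_k}\le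 P_0\le\frac{\mu}{\gamma}\Big(\frac{(NR)^N}{(I/P)^{N-1}}\Big)^{\frac1{2N-1}}\quad\text{for all }k,$$ $$P\ge\Big(\frac{\delta}{2-(\gamma+\tau)}\sum_k I_k\Big)^{\frac{2N-1}{N-1}}\frac{R}{(NI)^{N/(N-1)}} .$$ Then even distributions on the grid exist, and with every even distribution the parallel general algorithm is a $(\gamma,\delta)$-balanced parallel MTTKRP algorithm whose cost is at most $$C\cdot\Big(2\Big(\frac{NIR}{P}\Big)^{\frac N{2N-1}}-\gamma\frac IP-\delta\sum_k\frac{I_kR}{P}\Big)$$ and at most $C$ times the cost of any $(\gamma,\delta)$-balanced parallel MTTKRP algorithm on $P$ processors for the same problem. -/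

import Mathlib

noncomputable section

namespace MTTKRP

open Finset

/-! ## The problem -/

/-- The sizes of an MTTKRP problem: an `N`-way tensor `X` of dimensions `I 0 × ⋯ × I (N-1)`,
the number `R` of columns of the factor matrices, and the mode `n` of the output matrix. -/
structure Problem where
  N : ℕ
  I : Fin N → ℕ
  R : ℕ
  n : Fin N

section Machine

variable (S : Problem)

/-- Positions of the tensor. -/
abbrev Problem.TensorIdx : Type := ∀ k, Fin (S.I k)

/-- Positions of the input factor matrices `A k`, `k ≠ n`: a mode, a row and a column. -/
abbrev Problem.FactorIdx : Type := (k : {k : Fin S.N // k ≠ S.n}) × (Fin (S.I k.1) × Fin S.R)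

/-- Positions of the output matrix `B`. -/
abbrev Problem.OutIdx : Type := Fin (S.I S.n) × Fin S.R

/-- The iteration space; `(i, r)` stands for the product `X(i) * ∏ k ≠ n, A k (i k, r)`. -/
abbrev Problem.Iter : Type := S.TensorIdx × Fin S.R

/-- The number of tensor entries. -/
def Problem.size : ℕ := ∏ k, S.I k

/-- The number of factor matrix entries (inputs and output). -/
def Problem.factorSize : ℕ := ∑ k, S.I k * S.R

/-- The output entry to which a product contributes. -/
def Problem.target (x : S.Iter) : S.OutIdx := (x.1 S.n, x.2)

/-- The products whose sum is the output entry `o`, each once. -/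
def Problem.terms (o : S.OutIdx) : Finset S.Iter := univ.filter fun x => S.target x = o

/-! ## The parallel machine

Values are formal, since the arithmetic is that of an arbitrary set with two operations: a value is
an input entry or a sum of products. A product is only ever formed as one atomic multiply of an
entry of `X` with an entry of each input factor matrix. Sums are kept up to order and bracketing,
that is, as multisets of products; `psum 0` is an accumulator to which nothing has been added. -/

inductive Value : Type
  | tensor (i : S.TensorIdx)
  | factor (a : S.FactorIdx)
  | psum (m : Multiset S.Iter)

/-- Instructions. `mul p i r`: processor `p` evaluates the product with index `(i, r)`.
`add p a b`: processor `p` adds two sums of products.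
`comm p q v`: processor `p` sends the single value `v`, and processor `q` receives it. -/
inductive Instr (Proc : Type) : Type
  | mul (p : Proc) (i : S.TensorIdx) (r : Fin S.R)
  | add (p : Proc) (a b : Multiset S.Iter)
  | comm (src dst : Proc) (v : Value S)

/-- The contents of the local memories. Their capacity is not restricted. -/
abbrev State (Proc : Type) : Type := Proc → Set (Value S)

variable {S} {Proc : Type}

/-- The operands of an instruction are in the local memory of the processor that uses them. -/
def Instr.Enabled (σ : State S Proc) : Instr S Proc → Prop
  | .mul p i r => .tensor i ∈ σ p ∧ ∀ k : {k : Fin S.N // k ≠ S.n}, .factor ⟨k, i k.1, r⟩ ∈ σ p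
  | .add p a b => .psum a ∈ σ p ∧ .psum b ∈ σ p
  | .comm src _ v => v ∈ σ src

/-- The processor that obtains the result of an instruction. -/
def Instr.dst : Instr S Proc → Proc
  | .mul p _ _ => p
  | .add p _ _ => p
  | .comm _ q _ => q

/-- The result of an instruction. -/
def Instr.result : Instr S Proc → Value S
  | .mul _ i r => .psum {(i, r)}
  | .add _ a b => .psum (a + b)
  | .comm _ _ v => v

/-- The effect of an instruction on the local memories. -/
def Instr.step (σ : State S Proc) (c : Instr S Proc) : State S Proc :=
  fun q => {v | v ∈ σ q ∨ (q = c.dst ∧ v = c.result)}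

/-- A program (the instructions of all processors, in some sequential order that is compatible
with the parallel execution) finds all its operands in place. -/
def Legal : State S Proc → List (Instr S Proc) → Prop
  | _, [] => True
  | σ, c :: cs => c.Enabled σ ∧ Legal (c.step σ) cs

/-- The local memories after a program. -/
def run (σ : State S Proc) (cs : List (Instr S Proc)) : State S Proc := cs.foldl Instr.step σ

/-- The number of sends plus the number of receives of processor `p` in one instruction. -/
def Instr.words [DecidableEq Proc] (p : Proc) : Instr S Proc → ℕ
  | .comm src dst _ => (if src = p then 1 else 0) + (if dst = p then 1 else 0)
  | _ => 0

variable (S Proc) in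
/-- A parallel algorithm: the input entries that each processor owns before the execution, the
output entries that it owns after the execution, and the program. -/
structure ParAlg where
  initX : Proc → Finset S.TensorIdx
  initA : Proc → Finset S.FactorIdx
  finalB : Proc → Finset S.OutIdx
  prog : List (Instr S Proc)

/-- Initially a processor holds the input entries that it owns (and empty accumulators). -/
def ParAlg.initState (A : ParAlg S Proc) : State S Proc := fun p =>
  {v | (∃ i ∈ A.initX p, v = .tensor i) ∨ (∃ a ∈ A.initA p, v = .factor a) ∨ v = .psum 0}

/-- The algorithm is a parallel MTTKRP algorithm: it can be executed, every output entry is owned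
by some processor in the end, and each processor then holds the output entries that it owns. -/
def ParAlg.IsMTTKRP (A : ParAlg S Proc) : Prop :=
  Legal A.initState A.prog ∧
  (∀ o, ∃ p, o ∈ A.finalB p) ∧
  ∀ p, ∀ o ∈ A.finalB p, .psum (S.terms o).val ∈ run A.initState A.prog p

variable [Fintype Proc]

/-- Initially and finally, every processor owns at most `γ I / P` tensor entries and at most
`δ (∑ k, I k * R) / P` factor matrix entries. -/
def ParAlg.LoadBalanced (A : ParAlg S Proc) (γ δ : ℝ) : Prop :=
  ∀ p, ((A.initX p).card : ℝ) ≤ γ * S.size / Fintype.card Proc ∧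
    ((A.initA p).card + (A.finalB p).card : ℝ) ≤ δ * S.factorSize / Fintype.card Proc

variable [DecidableEq Proc]

/-- The communication cost: the largest number of sends and receives of a processor. -/
def ParAlg.cost (A : ParAlg S Proc) : ℕ :=
  univ.sup fun p => (A.prog.map (Instr.words p)).sum

/-! ## Collectives

The members of a communicator form a ring, given by a list; the left neighbour of position `j` is
position `j - 1`, cyclically. -/

/-- Bucket All-Gather, in `L.length - 1` steps. In step `s` position `j` passes to its left
neighbour the block `blk` of position `j + s`. -/
def allGather (L : List Proc) (blk : Proc → List (Value S)) : List (Instr S Proc) :=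
  (List.range (L.length - 1)).flatMap fun s =>
    (List.finRange L.length).flatMap fun j =>
      (blk (L.get ((finRotate L.length ^ s) j))).map fun v =>
        .comm (L.get j) (L.get ((finRotate L.length).symm j)) v

/-- Bucket Reduce-Scatter, in `L.length - 1` steps. Processor `p` contributes the sum
`contrib p o` to the output entry `o`; the total of the output entries in `blk p` is to arrive
at `p`. In step `s` position `j` passes to its left neighbour, for the block of position `j + s + 1`,
the sum of the contributions of positions `j, …, j + s`; the neighbour adds its own. -/
def reduceScatter (L : List Proc) (contrib : Proc → S.OutIdx → Multiset S.Iter)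
    (blk : Proc → List S.OutIdx) : List (Instr S Proc) :=
  (List.range (L.length - 1)).flatMap fun s =>
    (List.finRange L.length).flatMap fun j =>
      (blk (L.get ((finRotate L.length ^ (s + 1)) j))).flatMap fun o =>
        let left := L.get ((finRotate L.length).symm j)
        let acc := ∑ t ∈ range (s + 1), contrib (L.get ((finRotate L.length ^ t) j)) o
        [.comm (L.get j) left (.psum acc), .add left acc (contrib left o)]

/-- Run a collective in every communicator, where the communicators consist of the processors with
equal value of `key`. -/
def onEach {κ : Type} [Fintype κ] [DecidableEq κ] (key : Proc → κ)
    (f : List Proc → List (Instr S Proc)) : List (Instr S Proc) :=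
  (univ : Finset κ).toList.flatMap fun c => f (univ.filter fun p => key p = c).toList

/-- Processor `p` evaluates the products in a list and adds them, one by one, to the sum `acc`. -/
def accumulate (p : Proc) : Multiset S.Iter → List S.Iter → List (Instr S Proc)
  | _, [] => []
  | acc, x :: xs => .mul p x.1 x.2 :: .add p acc {x} :: accumulate p (acc + {x}) xs

end Machine

/-! ## The parallel general MTTKRP algorithm -/

/-- The shape `P₀ × P 0 × ⋯ × P (N-1)` of an `(N+1)`-way processor grid. -/
structure Grid (N : ℕ) where
  P₀ : ℕ
  P : Fin N → ℕ

/-- The processors of a grid. -/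
abbrev Grid.Proc {N : ℕ} (G : Grid N) : Type := Fin G.P₀ × (∀ k, Fin (G.P k))

/-- The number of processors of a grid. -/
def Grid.size {N : ℕ} (G : Grid N) : ℕ := G.P₀ * ∏ k, G.P k

/-- A data distribution on a grid. Each dimension `k` of the tensor is cut into `P k` parts
(`part k` tells which one a row is in) and the columns are cut into `P₀` parts. The entries of the
subtensor with parts `(p₁, …, p_N)` are distributed arbitrarily over the processors
`(·, p₁, …, p_N)`. For each `k`, the entries of the `k`-th factor matrix with row part `p_k` and
column part `p₀` are distributed arbitrarily over the processors with these two coordinates; for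
`k ≠ n` this is the input matrix `A k`, and for `k = n` the output matrix `B`. -/
structure Distribution (S : Problem) (G : Grid S.N) where
  part : ∀ k, Fin (S.I k) → Fin (G.P k)
  colPart : Fin S.R → Fin G.P₀
  ownerX : S.TensorIdx → G.Proc
  ownerX_part : ∀ i k, (ownerX i).2 k = part k (i k)
  ownerM : ∀ k, Fin (S.I k) → Fin S.R → G.Proc
  ownerM_part : ∀ k a r, (ownerM k a r).2 k = part k a
  ownerM_colPart : ∀ k a r, (ownerM k a r).1 = colPart r

namespace Distribution

variable {S : Problem} {G : Grid S.N} (D : Distribution S G)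

/-- The tensor entries owned by `p`. -/
def locX (p : G.Proc) : Finset S.TensorIdx := univ.filter fun i => D.ownerX i = p

/-- The entries of the `k`-th factor matrix owned by `p`. -/
def locM (k : Fin S.N) (p : G.Proc) : Finset (Fin (S.I k) × Fin S.R) :=
  univ.filter fun a => D.ownerM k a.1 a.2 = p

/-- The entries are spread evenly, up to rounding. -/
def Even : Prop :=
  ∀ p, (D.locX p).card ≤ (∏ k, (S.I k ⌈/⌉ G.P k)) ⌈/⌉ G.P₀ ∧
    ∀ k, (D.locM k p).card ≤
      ((S.I k ⌈/⌉ G.P k) * (S.R ⌈/⌉ G.P₀)) ⌈/⌉ (G.size / (G.P k * G.P₀))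

/-- The products of the local MTTKRP of `p` that contribute to the output entry `o`. -/
def localTerms (p : G.Proc) (o : S.OutIdx) : Finset S.Iter :=
  (S.terms o).filter fun x => D.colPart x.2 = p.1 ∧ ∀ k, D.part k (x.1 k) = p.2 k

/-- The output entries to which the local MTTKRP of `p` contributes. -/
def localOut (p : G.Proc) : Finset S.OutIdx :=
  univ.filter fun o => D.colPart o.2 = p.1 ∧ D.part S.n o.1 = p.2 S.n

/-- All-Gather of the subtensors, over the processors with equal `(p₁, …, p_N)`. -/
def gatherX : List (Instr S G.Proc) :=
  onEach (fun p : G.Proc => p.2) fun L => allGather L fun p => (D.locX p).toList.map .tensor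

/-- All-Gather of the blocks of `A k`, over the processors with equal `(p₀, p_k)`. -/
def gatherA (k : {k : Fin S.N // k ≠ S.n}) : List (Instr S G.Proc) :=
  onEach (fun p : G.Proc => (p.1, p.2 k.1)) fun L =>
    allGather L fun p => (D.locM k.1 p).toList.map fun a => .factor ⟨k, a⟩

/-- The local MTTKRPs. -/
def localMTTKRP : List (Instr S G.Proc) :=
  (univ : Finset G.Proc).toList.flatMap fun p =>
    (D.localOut p).toList.flatMap fun o => accumulate p 0 (D.localTerms p o).toList

/-- Reduce-Scatter of the blocks of `B`, over the processors with equal `(p₀, p_n)`. -/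
def scatterB : List (Instr S G.Proc) :=
  onEach (fun p : G.Proc => (p.1, p.2 S.n)) fun L =>
    reduceScatter L (fun p o => (D.localTerms p o).val) fun p => (D.locM S.n p).toList

/-- The parallel general MTTKRP algorithm. -/
def parGen : ParAlg S G.Proc where
  initX := D.locX
  initA p := univ.sigma fun k => D.locM k.1 p
  finalB := D.locM S.n
  prog := D.gatherX ++ (univ.toList.flatMap D.gatherA) ++ D.localMTTKRP ++ D.scatterB

end Distribution

/-! ## Optimality -/

/-- The grid consists of at least one processor, and the dimensions of the tensor and the rank are
large enough relative to the grid for a data distribution that is even up to rounding to own at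
most `γ I / P` tensor entries and `δ (∑ k, I k * R) / P` factor matrix entries per processor. -/
def Fits (S : Problem) (G : Grid S.N) (α β γ δ : ℝ) : Prop :=
  0 < G.P₀ ∧ (G.P₀ : ℝ) ≤ (β - 1) * S.R ∧ (G.size : ℝ) ≤ (γ - α) * S.size ∧
  ∀ k, 0 < G.P k ∧ (G.P k : ℝ) ≤ (α ^ (1 / S.N : ℝ) - 1) * S.I k ∧
    (G.size : ℝ) ≤ (δ - α ^ (1 / S.N : ℝ) * β) * (S.I k * S.R)

/-- On the grid `G` the parallel general algorithm is communication optimal up to the factor `C`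
among the parallel MTTKRP algorithms with the same number of processors and the balance constants
`γ`, `δ`, and its cost matches the quantity `lb` up to the factor `C`: even distributions exist,
and with any of them the algorithm is a balanced MTTKRP algorithm whose cost is at most `C * lb`
and at most `C` times the cost of any balanced parallel MTTKRP algorithm. -/
def CommOptimal (S : Problem) (G : Grid S.N) (γ δ C lb : ℝ) : Prop :=
  (∃ D : Distribution S G, D.Even) ∧
  ∀ D : Distribution S G, D.Even →
    D.parGen.IsMTTKRP ∧ D.parGen.LoadBalanced γ δ ∧ (D.parGen.cost : ℝ) ≤ C * lb ∧
    ∀ A : ParAlg S (Fin G.size), A.IsMTTKRP → A.LoadBalanced γ δ →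
      (D.parGen.cost : ℝ) ≤ C * A.cost

/-- The memory-independent lower bound that is strong when `N R ≥ (I / P) ^ (1 - 1 / N)`. -/
def lbGeneral (S : Problem) (P γ δ : ℝ) : ℝ :=
  2 * (S.N * S.size * S.R / P) ^ ((S.N : ℝ) / (2 * S.N - 1)) - γ * S.size / P
    - δ * S.factorSize / P

/-- The memory-independent lower bound that is strong when `N R ≤ (I / P) ^ (1 - 1 / N)`. -/
def lbStationary (S : Problem) (P γ δ : ℝ) : ℝ :=
  min ((2 / (3 * γ)) ^ (1 - 1 / S.N : ℝ) * (S.N * S.R) * (S.size / P) ^ (1 / S.N : ℝ)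
    - δ * S.factorSize / P) (γ * S.size / (2 * P))

end MTTKRP

end

noncomputable section

namespace MTTKRP

open Finset

/-! ### Monotonicity of execution -/

section Execution

variable {S : Problem} {Proc : Type}

/-! Upper and lower bounds on communication are compared with one intermediate quantity in each
regime.

Upper bound. In a step of a bucket collective a processor sends at most one block and receives at
most one, so a ring of `q` processors costs at most `2(q - 1)` blocks. The size conditions absorb
all rounding: blocks have at most `γ I / P` tensor entries and `δ I_k R / P` matrix entries. The
cost is therefore at most `2 (P₀ - 1) γ I / P + 2 R ∑ k, δ I_k / (P_k P₀)` (`Fits.cost_parGen_le`).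

Lower bound. Tracing each output sum back to its products shows that every product is evaluated by
some processor that owns the output entry or sends on a sum containing the product and belonging to
that entry alone. By pigeonhole some processor has at least `I R / P` such products. If they involve
`x` tensor entries and `M` matrix entries (outputs included), then `N I R / P ≤ x ^ (1 - 1/N) * M`
(`card_le_access`). Whatever is not owned is communicated, so `x` and `M` exceed the owned amounts
by at most the cost (`exists_access`).

Few columns: either `x` exceeds the owned share by half of it, or `M ≥ c N R (I/P)^(1/N)`. With `P₀
= 1` the tensor does not move, and both sides are of order `N R (I/P)^(1/N)`.

Many columns: with `K = (N I R / P)^(N/(2N-1))` the access inequality forces `x + M ≥ 2K` as soon as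
`x ≥ K`, while the processor owns at most `(2 - τ) K` entries. The conditions on `P₀` make both
parts of the upper bound of order `K`. -/

theorem subset_step (σ : State S Proc) (c : Instr S Proc) : σ ≤ c.step σ :=
  fun _ _ hv => Or.inl hv

theorem result_mem_step (σ : State S Proc) (c : Instr S Proc) : c.result ∈ c.step σ c.dst :=
  Or.inr ⟨rfl, rfl⟩

theorem Instr.Enabled.mono {σ τ : State S Proc} (h : σ ≤ τ) {c : Instr S Proc}
    (hc : c.Enabled σ) : c.Enabled τ := by
  cases c with
  | mul p i r => exact ⟨h _ hc.1, fun k => h _ (hc.2 k)⟩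
  | add p a b => exact ⟨h _ hc.1, h _ hc.2⟩
  | comm p q v => exact h _ hc

theorem Instr.step_mono {σ τ : State S Proc} (h : σ ≤ τ) (c : Instr S Proc) :
    c.step σ ≤ c.step τ := by
  rintro q v (hv | hv)
  · exact Or.inl (h _ hv)
  · exact Or.inr hv

theorem run_cons (σ : State S Proc) (c : Instr S Proc) (l : List (Instr S Proc)) :
    run σ (c :: l) = run (c.step σ) l := rfl

theorem run_append (σ : State S Proc) (l l' : List (Instr S Proc)) :
    run σ (l ++ l') = run (run σ l) l' := List.foldl_append

theorem le_run (σ : State S Proc) (l : List (Instr S Proc)) : σ ≤ run σ l := by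
  induction l generalizing σ with
  | nil => exact le_rfl
  | cons c l ih => exact (subset_step σ c).trans (ih _)

theorem run_mono {σ τ : State S Proc} (h : σ ≤ τ) (l : List (Instr S Proc)) :
    run σ l ≤ run τ l := by
  induction l generalizing σ τ with
  | nil => exact h
  | cons c l ih => exact ih (c.step_mono h)

theorem Legal.mono {σ τ : State S Proc} (h : σ ≤ τ) {l : List (Instr S Proc)}
    (hl : Legal σ l) : Legal τ l := by
  induction l generalizing σ τ with
  | nil => trivial
  | cons c l ih => exact ⟨hl.1.mono h, ih (c.step_mono h) hl.2⟩

theorem legal_append {σ : State S Proc} {l l' : List (Instr S Proc)} :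
    Legal σ (l ++ l') ↔ Legal σ l ∧ Legal (run σ l) l' := by
  induction l generalizing σ with
  | nil => simp [Legal, run]
  | cons c l ih => simp only [List.cons_append, Legal, ih, and_assoc, run_cons]

/-- Nothing is ever erased, so programs that are separately executable from `σ` remain so one after
another. -/
theorem legal_flatMap {α : Type*} {σ : State S Proc} {f : α → List (Instr S Proc)} {xs : List α}
    (h : ∀ x ∈ xs, Legal σ (f x)) : Legal σ (xs.flatMap f) := by
  induction xs generalizing σ with
  | nil => trivial
  | cons x xs ih =>
    rw [List.flatMap_cons, legal_append]
    exact ⟨h x (by simp), ih fun y hy => (h y (by simp [hy])).mono (le_run _ _)⟩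

theorem run_le_run_flatMap {α : Type*} (σ : State S Proc) (f : α → List (Instr S Proc))
    {xs : List α} {x : α} (hx : x ∈ xs) : run σ (f x) ≤ run σ (xs.flatMap f) := by
  induction xs generalizing σ with
  | nil => simp at hx
  | cons y xs ih =>
    rw [List.flatMap_cons, run_append]
    rcases List.mem_cons.1 hx with rfl | hx
    · exact le_run _ _
    · exact (run_mono (le_run _ _) _).trans (ih _ hx)

theorem legal_map {α : Type*} {σ : State S Proc} {f : α → Instr S Proc} {xs : List α}
    (h : ∀ x ∈ xs, (f x).Enabled σ) : Legal σ (xs.map f) := by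
  rw [List.map_eq_flatMap]
  exact legal_flatMap fun x hx => ⟨h x hx, trivial⟩

theorem result_mem_run_map {α : Type*} (σ : State S Proc) (f : α → Instr S Proc)
    {xs : List α} {x : α} (hx : x ∈ xs) : (f x).result ∈ run σ (xs.map f) (f x).dst := by
  rw [List.map_eq_flatMap]
  exact run_le_run_flatMap σ (fun x => [f x]) hx _ (result_mem_step σ (f x))

/-- A program that proceeds in steps is executed by maintaining an invariant. -/
theorem legal_flatMap_range (Inv : ℕ → State S Proc → Prop) {σ : State S Proc}
    {f : ℕ → List (Instr S Proc)} (m : ℕ) (h0 : Inv 0 σ)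
    (h : ∀ s < m, ∀ τ, Inv s τ → Legal τ (f s) ∧ Inv (s + 1) (run τ (f s))) :
    Legal σ ((List.range m).flatMap f) ∧ Inv m (run σ ((List.range m).flatMap f)) := by
  induction m with
  | zero => exact ⟨trivial, h0⟩
  | succ m ih =>
    obtain ⟨h1, h2⟩ := ih fun s hs => h s (hs.trans m.lt_succ_self)
    rw [List.range_succ, List.flatMap_append, legal_append, run_append]
    have := h m m.lt_succ_self _ h2
    simp only [List.flatMap_cons, List.flatMap_nil, List.append_nil]
    exact ⟨⟨h1, this.1⟩, this.2⟩

theorem accumulate_correct {p : Proc} {xs : List S.Iter} {acc : Multiset S.Iter}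
    {σ : State S Proc} (hacc : .psum acc ∈ σ p) (hx : ∀ x ∈ xs, .tensor x.1 ∈ σ p ∧
      ∀ k : {k : Fin S.N // k ≠ S.n}, .factor ⟨k, x.1 k.1, x.2⟩ ∈ σ p) :
    Legal σ (accumulate p acc xs) ∧
      .psum (acc + (xs : Multiset S.Iter)) ∈ run σ (accumulate p acc xs) p := by
  induction xs generalizing acc σ with
  | nil => exact ⟨trivial, by simpa [accumulate, run] using hacc⟩
  | cons x xs ih =>
    have h1 : .psum {x} ∈ Instr.step σ (.mul p x.1 x.2) p := result_mem_step σ (.mul p x.1 x.2)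
    have hle := (subset_step σ (.mul p x.1 x.2)).trans
      (subset_step (Instr.step σ (.mul p x.1 x.2)) (.add p acc {x}))
    obtain ⟨h2, h3⟩ := ih (acc := acc + {x})
      (result_mem_step (Instr.step σ (.mul p x.1 x.2)) (.add p acc {x}))
      fun y hy => ⟨hle _ (hx y (by simp [hy])).1, fun k => hle _ ((hx y (by simp [hy])).2 k)⟩
    refine ⟨⟨hx x (by simp), ⟨subset_step _ _ _ hacc, h1⟩, h2⟩, ?_⟩
    rw [add_assoc, Multiset.singleton_add, Multiset.cons_coe] at h3
    exact h3

end Execution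

/-! ### Offsets on a ring -/

section Rotation

/-- A block at offset `s` from a position is at offset `s + 1` from its left neighbour; hence each
pass to the left raises the offset by one. -/
theorem finRotate_pow_symm {n : ℕ} (s : ℕ) (j : Fin n) :
    (finRotate n ^ (s + 1)) ((finRotate n).symm j) = (finRotate n ^ s) j := by
  rw [pow_succ, Equiv.Perm.mul_apply, Equiv.apply_symm_apply]

theorem val_finRotate_pow {n : ℕ} (s : ℕ) (j : Fin n) :
    ((finRotate n ^ s) j : ℕ) = (j + s) % n := by
  cases n with
  | zero => exact j.elim0
  | succ n =>
    induction s with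
    | zero => simp [Nat.mod_eq_of_lt j.2]
    | succ s ih =>
      rw [pow_succ', Equiv.Perm.mul_apply, finRotate_apply, Fin.val_add, ih, Fin.val_one',
        ← Nat.add_mod, add_assoc]

theorem finRotate_pow_self {n : ℕ} (j : Fin n) : (finRotate n ^ n) j = j :=
  Fin.ext <| by rw [val_finRotate_pow, Nat.add_mod_right, Nat.mod_eq_of_lt j.2]

theorem exists_finRotate_pow {n : ℕ} (i j : Fin n) : ∃ t ≤ n - 1, (finRotate n ^ t) j = i := by
  -- The offset is `i - j` modulo `n`, arranged so that the subtraction does not truncate.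
  refine ⟨(i + (n - j)) % n, Nat.le_sub_one_of_lt (Nat.mod_lt _ (i.pos)), Fin.ext ?_⟩
  rw [val_finRotate_pow, Nat.add_mod_mod, show (j : ℕ) + (i + (n - j)) = i + n by omega,
    Nat.add_mod_right, Nat.mod_eq_of_lt i.2]

theorem sum_range_finRotate_pow {n : ℕ} {M : Type*} [AddCommMonoid M] (f : Fin n → M)
    (j : Fin n) : ∑ t ∈ range n, f ((finRotate n ^ t) j) = ∑ i, f i := by
  rw [← Fin.sum_univ_eq_sum_range (fun t => f ((finRotate n ^ t) j))]
  refine Function.Bijective.sum_comp (e := fun t : Fin n => (finRotate n ^ (t : ℕ)) j) ?_ f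
  refine Finite.surjective_iff_bijective.1 fun i => ?_
  obtain ⟨t, ht, h⟩ := exists_finRotate_pow i j
  exact ⟨⟨t, by have := i.pos; omega⟩, h⟩

end Rotation

/-! ### Correctness of the bucket collectives -/

section Collectives

variable {S : Problem} {Proc : Type}

/-- Invariant: after `s` steps, position `j` holds the blocks at offsets `0, …, s`. Offsets up to
`L.length - 1` reach the whole ring. -/
theorem allGather_correct {L : List Proc} {blk : Proc → List (Value S)} {σ : State S Proc}
    (h : ∀ p ∈ L, ∀ v ∈ blk p, v ∈ σ p) :
    Legal σ (allGather L blk) ∧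
      ∀ p ∈ L, ∀ q ∈ L, ∀ v ∈ blk q, v ∈ run σ (allGather L blk) p := by
  obtain ⟨h1, h2⟩ := legal_flatMap_range (S := S) (Proc := Proc) (σ := σ)
    (fun s τ => ∀ j, ∀ t ≤ s, ∀ v ∈ blk (L.get ((finRotate L.length ^ t) j)), v ∈ τ (L.get j))
    (f := fun s => (List.finRange L.length).flatMap fun j =>
      (blk (L.get ((finRotate L.length ^ s) j))).map fun v =>
        .comm (L.get j) (L.get ((finRotate L.length).symm j)) v) (L.length - 1)
    (by
      intro j t ht v hv
      obtain rfl : t = 0 := by omega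
      exact h _ (List.get_mem _ _) v hv)
    (by
      intro s _ τ hτ
      refine ⟨legal_flatMap fun j _ => legal_map fun v hv => hτ j s le_rfl v hv, ?_⟩
      intro j t ht v hv
      rcases ht.lt_or_eq with ht | rfl
      · exact le_run _ _ _ (hτ j t (by omega) v hv)
      -- The block at the new offset `s + 1` arrives from the right neighbour of `j`, for which it
      -- has offset `s`.
      · have hj : (finRotate L.length).symm (finRotate L.length j) = j :=
          Equiv.symm_apply_apply _ _
        rw [← hj, finRotate_pow_symm] at hv
        have := result_mem_run_map τ (fun v => Instr.comm (L.get (finRotate L.length j))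
          (L.get ((finRotate L.length).symm (finRotate L.length j))) v) hv
        rw [hj] at this
        refine run_le_run_flatMap τ _ (List.mem_finRange (finRotate L.length j)) _ ?_
        rw [hj]
        exact this)
  refine ⟨h1, fun p hp q hq v hv => ?_⟩
  obtain ⟨j, rfl⟩ := List.get_of_mem hp
  obtain ⟨i, rfl⟩ := List.get_of_mem hq
  obtain ⟨t, ht, rfl⟩ := exists_finRotate_pow i j
  exact h2 j t ht v hv

/-- Invariant: after `s` steps, position `j` holds, for the block at offset `s + 1`, the sum over
positions `j, …, j + s`. At `s + 1 = L.length` the offset has wrapped around to the position's own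
block and the sum is complete. The clause `σ ≤ τ` keeps the original contributions available. -/
theorem reduceScatter_correct {L : List Proc} {contrib : Proc → S.OutIdx → Multiset S.Iter}
    {blk : Proc → List S.OutIdx} {σ : State S Proc}
    (h : ∀ p ∈ L, ∀ q ∈ L, ∀ o ∈ blk q, .psum (contrib p o) ∈ σ p) :
    Legal σ (reduceScatter L contrib blk) ∧
      ∀ p ∈ L, ∀ o ∈ blk p,
        .psum ((L.map fun q => contrib q o).sum) ∈ run σ (reduceScatter L contrib blk) p := by
  set ρ := finRotate L.length
  obtain ⟨h1, h2⟩ := legal_flatMap_range (S := S) (Proc := Proc) (σ := σ)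
    (fun s τ => σ ≤ τ ∧ ∀ j, ∀ o ∈ blk (L.get ((ρ ^ (s + 1)) j)),
      .psum (∑ t ∈ range (s + 1), contrib (L.get ((ρ ^ t) j)) o) ∈ τ (L.get j))
    (f := fun s => (List.finRange L.length).flatMap fun j =>
      (blk (L.get ((finRotate L.length ^ (s + 1)) j))).flatMap fun o =>
        let left := L.get ((finRotate L.length).symm j)
        let acc := ∑ t ∈ range (s + 1), contrib (L.get ((finRotate L.length ^ t) j)) o
        [.comm (L.get j) left (.psum acc), .add left acc (contrib left o)]) (L.length - 1)
    (by
      refine ⟨le_rfl, fun j o ho => ?_⟩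
      simpa using h _ (List.get_mem _ _) _ (List.get_mem _ _) o ho)
    (by
      rintro s _ τ ⟨hστ, hτ⟩
      refine ⟨legal_flatMap fun j _ => legal_flatMap fun o ho => ?_,
        hστ.trans (le_run _ _), ?_⟩
      · refine ⟨hτ j o ho, ⟨result_mem_step τ (.comm _ _ _), subset_step _ _ _ ?_⟩, trivial⟩
        exact hστ _ (h _ (List.get_mem _ _) _ (List.get_mem _ _) o ho)
      · intro j o ho
        have hj : ρ.symm (ρ j) = j := Equiv.symm_apply_apply _ _
        have ho' : o ∈ blk (L.get ((ρ ^ (s + 1)) (ρ j))) := by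
          rw [← hj, finRotate_pow_symm] at ho
          exact ho
        refine run_le_run_flatMap τ _ (List.mem_finRange (ρ j)) _ ?_
        refine run_le_run_flatMap τ _ ho' _ ?_
        refine Or.inr ⟨congrArg L.get hj.symm, ?_⟩
        simp only [Instr.result, Value.psum.injEq]
        -- The term `t = 0` is the receiver's own contribution; the others are the incoming sum,
        -- shifted by one.
        rw [sum_range_succ']
        simp only [ρ, Equiv.symm_apply_apply, pow_zero, Equiv.Perm.coe_one, id_eq, pow_succ,
          Equiv.Perm.mul_apply])
  refine ⟨h1, fun p hp o ho => ?_⟩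
  obtain ⟨j, rfl⟩ := List.get_of_mem hp
  have hlen : L.length - 1 + 1 = L.length := by have := j.pos; omega
  have := h2.2 j o (by rw [hlen, finRotate_pow_self]; exact ho)
  rw [hlen, sum_range_finRotate_pow (fun i => contrib (L.get i) o), Fin.sum_univ_def] at this
  have hL : (List.finRange L.length).map (fun i => contrib (L.get i) o)
      = L.map fun q => contrib q o := by
    conv_rhs => rw [← List.map_get_finRange L]
    rw [List.map_map]
    rfl
  rw [hL] at this
  exact this

variable [Fintype Proc] {κ : Type} [Fintype κ] [DecidableEq κ]

theorem legal_onEach {key : Proc → κ} {f : List Proc → List (Instr S Proc)} {σ : State S Proc}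
    (h : ∀ c, Legal σ (f (univ.filter fun p => key p = c).toList)) : Legal σ (onEach key f) :=
  legal_flatMap fun c _ => h c

theorem run_le_run_onEach (key : Proc → κ) (f : List Proc → List (Instr S Proc))
    (σ : State S Proc) (c : κ) :
    run σ (f (univ.filter fun p => key p = c).toList) ≤ run σ (onEach key f) :=
  run_le_run_flatMap σ (fun c => f (univ.filter fun p => key p = c).toList) (by simp)

end Collectives

/-! ### Correctness of the parallel algorithm -/

namespace Distribution

variable {S : Problem} {G : Grid S.N} (D : Distribution S G)

theorem gatherX_correct {σ : State S G.Proc} (h : ∀ p, ∀ i ∈ D.locX p, .tensor i ∈ σ p) :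
    Legal σ D.gatherX ∧
      ∀ p i, (∀ k, D.part k (i k) = p.2 k) → .tensor i ∈ run σ D.gatherX p := by
  have key := fun c : ∀ k, Fin (G.P k) => allGather_correct
    (L := (univ.filter fun p : G.Proc => p.2 = c).toList)
    (blk := fun p => (D.locX p).toList.map .tensor) (σ := σ) (by
      intro p _ v hv
      obtain ⟨i, hi, rfl⟩ := List.mem_map.1 hv
      exact h p i (mem_toList.1 hi))
  refine ⟨legal_onEach fun c => (key c).1, fun p i hi => ?_⟩
  refine run_le_run_onEach (fun p : G.Proc => p.2) _ σ p.2 p ?_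
  refine (key p.2).2 p (by simp) (D.ownerX i) ?_ _ ?_
  · rw [mem_toList, mem_filter]
    exact ⟨mem_univ _, funext fun k => (D.ownerX_part i k).trans (hi k)⟩
  · exact List.mem_map_of_mem (by simp [locX])

theorem gatherA_correct (k : {k : Fin S.N // k ≠ S.n}) {σ : State S G.Proc}
    (h : ∀ p, ∀ a ∈ D.locM k.1 p, .factor ⟨k, a⟩ ∈ σ p) :
    Legal σ (D.gatherA k) ∧
      ∀ p : G.Proc, ∀ a : Fin (S.I k.1) × Fin S.R, D.part k.1 a.1 = p.2 k.1 →
        D.colPart a.2 = p.1 → .factor ⟨k, a⟩ ∈ run σ (D.gatherA k) p := by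
  have key := fun c : Fin G.P₀ × Fin (G.P k.1) => allGather_correct
    (L := (univ.filter fun p : G.Proc => (p.1, p.2 k.1) = c).toList)
    (blk := fun p => (D.locM k.1 p).toList.map fun a => .factor ⟨k, a⟩) (σ := σ) (by
      intro p _ v hv
      obtain ⟨i, hi, rfl⟩ := List.mem_map.1 hv
      exact h p i (mem_toList.1 hi))
  refine ⟨legal_onEach fun c => (key c).1, fun p a h1 h2 => ?_⟩
  refine run_le_run_onEach (fun p : G.Proc => (p.1, p.2 k.1)) _ σ (p.1, p.2 k.1) p ?_
  refine (key _).2 p (by simp) (D.ownerM k.1 a.1 a.2) ?_ _ ?_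
  · rw [mem_toList, mem_filter, D.ownerM_part, D.ownerM_colPart, h1, h2]
    exact ⟨mem_univ _, rfl⟩
  · exact List.mem_map_of_mem (by simp [locM])

theorem localMTTKRP_correct {σ : State S G.Proc}
    (hX : ∀ p i, (∀ k, D.part k (i k) = p.2 k) → .tensor i ∈ σ p)
    (hA : ∀ (k : {k : Fin S.N // k ≠ S.n}) (p : G.Proc) (a : Fin (S.I k.1) × Fin S.R),
      D.part k.1 a.1 = p.2 k.1 → D.colPart a.2 = p.1 → .factor ⟨k, a⟩ ∈ σ p)
    (h0 : ∀ p, .psum 0 ∈ σ p) :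
    Legal σ D.localMTTKRP ∧
      ∀ p, ∀ o ∈ D.localOut p, .psum (D.localTerms p o).val ∈ run σ D.localMTTKRP p := by
  have key := fun (p : G.Proc) (o : S.OutIdx) => accumulate_correct
    (p := p) (xs := (D.localTerms p o).toList) (h0 p) (fun x hx => by
      rw [mem_toList, localTerms, mem_filter] at hx
      exact ⟨hX p _ hx.2.2, fun k => hA k p (x.1 k.1, x.2) (hx.2.2 _) hx.2.1⟩)
  refine ⟨legal_flatMap fun p _ => legal_flatMap fun o _ => (key p o).1, fun p o ho => ?_⟩
  refine run_le_run_flatMap σ _ (mem_toList.2 (mem_univ p)) _ ?_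
  refine run_le_run_flatMap σ _ (mem_toList.2 ho) _ ?_
  have := (key p o).2
  rwa [coe_toList, zero_add] at this

/-- The contributions of the processors that share a block of `B` add up to its entries. -/
theorem sum_localTerms (o : S.OutIdx) :
    ∑ p : G.Proc with (p.1, p.2 S.n) = (D.colPart o.2, D.part S.n o.1), (D.localTerms p o).val
      = (S.terms o).val := by
  classical
  ext x
  rw [Multiset.count_sum']
  simp only [Multiset.count_eq_of_nodup (Finset.nodup _), Finset.mem_val]
  by_cases hx : x ∈ S.terms o
  -- Exactly one processor evaluates `x` in its local MTTKRP: the one whose coordinates are the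
  -- parts of `x`.
  · rw [if_pos hx, sum_eq_single (D.colPart x.2, fun k => D.part k (x.1 k))]
    · rw [if_pos]
      simp [localTerms, hx]
    · intro p _ hp
      rw [if_neg]
      intro h
      rw [localTerms, mem_filter] at h
      exact hp (Prod.ext h.2.1.symm (funext fun k => (h.2.2 k).symm))
    · intro h
      refine absurd ?_ h
      rw [mem_filter]
      obtain rfl := (mem_filter.1 hx).2
      exact ⟨mem_univ _, rfl⟩
  · rw [if_neg hx]
    exact sum_eq_zero fun p _ => if_neg fun h => hx (mem_filter.1 h).1

theorem scatterB_correct {σ : State S G.Proc}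
    (h : ∀ p, ∀ o ∈ D.localOut p, .psum (D.localTerms p o).val ∈ σ p) :
    Legal σ D.scatterB ∧
      ∀ p, ∀ o ∈ D.locM S.n p, .psum (S.terms o).val ∈ run σ D.scatterB p := by
  have owner : ∀ p, ∀ o ∈ D.locM S.n p, (D.colPart o.2, D.part S.n o.1) = (p.1, p.2 S.n) := by
    intro p o ho
    obtain rfl := (mem_filter.1 ho).2
    rw [D.ownerM_part, D.ownerM_colPart]
  have key := fun c : Fin G.P₀ × Fin (G.P S.n) => reduceScatter_correct
    (L := (univ.filter fun p : G.Proc => (p.1, p.2 S.n) = c).toList)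
    (contrib := fun p o => (D.localTerms p o).val)
    (blk := fun p => (D.locM S.n p).toList) (σ := σ) (by
      intro p hp q hq o ho
      rw [mem_toList, mem_filter] at hp hq
      have := owner q o (mem_toList.1 ho)
      rw [hq.2, ← hp.2, Prod.ext_iff] at this
      exact h p o (by simpa [localOut] using this))
  refine ⟨legal_onEach fun c => (key c).1, fun p o ho => ?_⟩
  refine run_le_run_onEach (fun p : G.Proc => (p.1, p.2 S.n)) _ σ (p.1, p.2 S.n) p ?_
  have := (key (p.1, p.2 S.n)).2 p (by simp) o (mem_toList.2 ho)
  rw [Finset.sum_map_toList, ← owner p o ho, D.sum_localTerms] at this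
  rw [← owner p o ho]
  exact this

/-- The parallel general algorithm is correct on every data distribution. -/
theorem parGen_isMTTKRP : D.parGen.IsMTTKRP := by
  obtain ⟨lX, hX⟩ := D.gatherX_correct (σ := D.parGen.initState)
    fun p i hi => Or.inl ⟨i, hi, rfl⟩
  set σ₁ := run D.parGen.initState D.gatherX
  have hσ₁ : D.parGen.initState ≤ σ₁ := le_run _ _
  have hA := fun k => D.gatherA_correct k (σ := σ₁) fun p a ha =>
    hσ₁ _ (Or.inr (Or.inl ⟨⟨k, a⟩, by simpa [parGen] using ha, rfl⟩))
  have lA : Legal σ₁ (univ.toList.flatMap D.gatherA) := legal_flatMap fun k _ => (hA k).1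
  set σ₂ := run σ₁ (univ.toList.flatMap D.gatherA)
  have hσ₂ : σ₁ ≤ σ₂ := le_run _ _
  obtain ⟨lL, hL⟩ := D.localMTTKRP_correct (σ := σ₂) (fun p i hi => hσ₂ _ (hX p i hi))
    (fun k p a h1 h2 => run_le_run_flatMap σ₁ _ (mem_toList.2 (mem_univ k)) _
      ((hA k).2 p a h1 h2))
    (fun p => hσ₂ _ (hσ₁ _ (Or.inr (Or.inr rfl))))
  obtain ⟨lB, hB⟩ := D.scatterB_correct hL
  refine ⟨?_, fun o => ⟨D.ownerM S.n o.1 o.2, by simp [parGen, locM]⟩, fun p o ho => ?_⟩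
  · simp only [parGen, legal_append, run_append]
    exact ⟨⟨⟨lX, lA⟩, lL⟩, lB⟩
  · simp only [parGen, run_append]
    exact hB p o ho

end Distribution

/-! ### Counting sends and receives -/

section Words

variable {S : Problem} {Proc : Type} [DecidableEq Proc]

/-- The number of sends plus the number of receives of `p` in a program. -/
def totalWords (p : Proc) (l : List (Instr S Proc)) : ℕ := (l.map (Instr.words p)).sum

theorem totalWords_append (p : Proc) (l l' : List (Instr S Proc)) :
    totalWords p (l ++ l') = totalWords p l + totalWords p l' := by
  simp [totalWords]

theorem totalWords_flatMap {α : Type*} (p : Proc) (f : α → List (Instr S Proc)) (xs : List α) :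
    totalWords p (xs.flatMap f) = (xs.map fun x => totalWords p (f x)).sum := by
  induction xs with
  | nil => rfl
  | cons x xs ih => rw [List.flatMap_cons, totalWords_append, ih, List.map_cons, List.sum_cons]

theorem totalWords_toList_flatMap {α : Type*} (p : Proc) (f : α → List (Instr S Proc))
    (s : Finset α) : totalWords p (s.toList.flatMap f) = ∑ x ∈ s, totalWords p (f x) := by
  rw [totalWords_flatMap, sum_map_toList]

theorem totalWords_accumulate (p q : Proc) (acc : Multiset S.Iter) (xs : List S.Iter) :
    totalWords p (accumulate q acc xs) = 0 := by
  induction xs generalizing acc with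
  | nil => rfl
  | cons x xs ih =>
    have := ih (acc + {x})
    simpa [totalWords, accumulate, Instr.words] using this

/-- In a step of a bucket collective a processor sends at most one block and receives at most
one block. -/
theorem sum_ring_words_le {L : List Proc} (hL : L.Nodup) (p : Proc) (b : ℕ)
    (size : Fin L.length → ℕ) (hb : ∀ j, size j ≤ b) :
    ∑ j, size j * ((if L.get j = p then 1 else 0) +
      (if L.get ((finRotate L.length).symm j) = p then 1 else 0)) ≤ 2 * b := by
  -- Without repetitions in the ring, `p` is the sender for at most one `j` and the receiver for at
  -- most one `j`.
  have hinj := List.nodup_iff_injective_get.1 hL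
  have one : ∀ g : Fin L.length → Fin L.length, Function.Injective g →
      (∑ j, if L.get (g j) = p then 1 else 0) ≤ 1 := by
    intro g hg
    rw [sum_boole, Nat.cast_id, card_le_one]
    intro i hi j hj
    rw [mem_filter] at hi hj
    exact hg (hinj (hi.2.trans hj.2.symm))
  calc _ ≤ ∑ j, b * ((if L.get j = p then 1 else 0) +
        (if L.get ((finRotate L.length).symm j) = p then 1 else 0)) :=
        sum_le_sum fun j _ => Nat.mul_le_mul_right _ (hb j)
    _ = b * ((∑ j, if L.get j = p then 1 else 0) +
        ∑ j, if L.get ((finRotate L.length).symm j) = p then 1 else 0) := by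
        rw [← mul_sum, sum_add_distrib]
    _ ≤ b * (1 + 1) := Nat.mul_le_mul_left _
        (add_le_add (one id Function.injective_id) (one _ (Equiv.injective _)))
    _ = 2 * b := by ring

theorem totalWords_allGather_le {L : List Proc} (hL : L.Nodup) (blk : Proc → List (Value S))
    (p : Proc) (b : ℕ) (hb : ∀ q, (blk q).length ≤ b) :
    totalWords p (allGather L blk) ≤ (L.length - 1) * (2 * b) := by
  rw [allGather, totalWords_flatMap]
  refine (List.sum_le_card_nsmul _ (2 * b) ?_).trans_eq (by simp)
  intro w hw
  obtain ⟨s, _, rfl⟩ := List.mem_map.1 hw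
  rw [totalWords_flatMap, ← Fin.sum_univ_def]
  refine le_of_eq_of_le (sum_congr rfl fun j _ => ?_) (sum_ring_words_le hL p b
    (fun j => (blk (L.get ((finRotate L.length ^ s) j))).length) fun j => hb _)
  simp [totalWords, Function.comp_def, Instr.words]

theorem totalWords_reduceScatter_le {L : List Proc} (hL : L.Nodup)
    (contrib : Proc → S.OutIdx → Multiset S.Iter) (blk : Proc → List S.OutIdx)
    (p : Proc) (b : ℕ) (hb : ∀ q, (blk q).length ≤ b) :
    totalWords p (reduceScatter L contrib blk) ≤ (L.length - 1) * (2 * b) := by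
  rw [reduceScatter, totalWords_flatMap]
  refine (List.sum_le_card_nsmul _ (2 * b) ?_).trans_eq (by simp)
  intro w hw
  obtain ⟨s, _, rfl⟩ := List.mem_map.1 hw
  rw [totalWords_flatMap, ← Fin.sum_univ_def]
  refine le_of_eq_of_le (sum_congr rfl fun j _ => ?_) (sum_ring_words_le hL p b
    (fun j => (blk (L.get ((finRotate L.length ^ (s + 1)) j))).length) fun j => hb _)
  rw [totalWords_flatMap]
  simp [totalWords, Instr.words]

theorem totalWords_allGather_of_notMem {L : List Proc} (blk : Proc → List (Value S))
    {p : Proc} (hp : p ∉ L) : totalWords p (allGather L blk) = 0 := by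
  have h : ∀ j, L.get j ≠ p := fun j hj => hp (hj ▸ List.get_mem L j)
  simp only [allGather, totalWords_flatMap]
  refine List.sum_eq_zero fun w hw => ?_
  obtain ⟨s, _, rfl⟩ := List.mem_map.1 hw
  refine List.sum_eq_zero fun w hw => ?_
  obtain ⟨j, _, rfl⟩ := List.mem_map.1 hw
  refine List.sum_eq_zero fun w hw => ?_
  simp only [List.map_map, List.mem_map, Function.comp, Instr.words] at hw
  obtain ⟨v, _, rfl⟩ := hw
  rw [if_neg (h _), if_neg (h _), add_zero]

theorem totalWords_reduceScatter_of_notMem {L : List Proc}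
    (contrib : Proc → S.OutIdx → Multiset S.Iter) (blk : Proc → List S.OutIdx)
    {p : Proc} (hp : p ∉ L) : totalWords p (reduceScatter L contrib blk) = 0 := by
  have h : ∀ j, L.get j ≠ p := fun j hj => hp (hj ▸ List.get_mem L j)
  simp only [reduceScatter, totalWords_flatMap]
  refine List.sum_eq_zero fun w hw => ?_
  obtain ⟨s, _, rfl⟩ := List.mem_map.1 hw
  refine List.sum_eq_zero fun w hw => ?_
  obtain ⟨j, _, rfl⟩ := List.mem_map.1 hw
  refine List.sum_eq_zero fun w hw => ?_
  obtain ⟨o, _, rfl⟩ := List.mem_map.1 hw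
  simp only [totalWords, List.map_cons, List.map_nil, Instr.words, if_neg (h _),
    List.sum_cons, List.sum_nil, add_zero]

variable [Fintype Proc] {κ : Type} [Fintype κ] [DecidableEq κ]

/-- A processor takes part in the collective of its own communicator only. -/
theorem totalWords_onEach (key : Proc → κ) (f : List Proc → List (Instr S Proc)) (p : Proc)
    (hf : ∀ L : List Proc, p ∉ L → totalWords p (f L) = 0) :
    totalWords p (onEach key f)
      = totalWords p (f (univ.filter fun q => key q = key p).toList) := by
  rw [onEach, totalWords_toList_flatMap]
  refine sum_eq_single_of_mem _ (mem_univ _) fun c _ hc => hf _ ?_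
  simpa using hc.symm

end Words

/-! ### Communicator sizes and the cost of the algorithm -/

theorem card_grid_proc {N : ℕ} (G : Grid N) : Fintype.card G.Proc = G.size := by
  simp [Grid.size]

theorem card_filter_snd_eq {N : ℕ} (G : Grid N) (c : ∀ k, Fin (G.P k)) :
    (univ.filter fun p : G.Proc => p.2 = c).card = G.P₀ := by
  have : (univ.filter fun p : G.Proc => p.2 = c) = univ ×ˢ {c} := by
    ext p
    simp only [mem_filter, mem_univ, true_and, mem_product, mem_singleton]
  rw [this, card_product, card_singleton, mul_one, card_univ, Fintype.card_fin]

theorem card_filter_key_mul {N : ℕ} (G : Grid N) (k : Fin N) (c : Fin G.P₀ × Fin (G.P k)) :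
    (univ.filter fun p : G.Proc => (p.1, p.2 k) = c).card * (G.P k * G.P₀) = G.size := by
  classical
  -- The condition guarded by `l = k` constrains coordinate `k` only, which exhibits the
  -- communicator as a product set.
  have : (univ.filter fun p : G.Proc => (p.1, p.2 k) = c)
      = {c.1} ×ˢ Fintype.piFinset fun l => univ.filter fun x : Fin (G.P l) =>
        ∀ h : l = k, h ▸ x = c.2 := by
    ext p
    simp only [mem_filter, mem_univ, true_and, mem_product, mem_singleton,
      Fintype.mem_piFinset, Prod.ext_iff]
    refine and_congr_right fun _ => ⟨fun h l hl => ?_, fun h => h k rfl⟩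
    subst hl
    exact h
  rw [this, card_product, card_singleton, one_mul, Fintype.card_piFinset, Grid.size,
    ← mul_prod_erase univ _ (mem_univ k), ← mul_prod_erase univ G.P (mem_univ k)]
  have hk : (univ.filter fun x : Fin (G.P k) => ∀ h : k = k, h ▸ x = c.2).card = 1 := by
    simp [filter_eq']
  have hl : ∏ l ∈ univ.erase k,
      (univ.filter fun x : Fin (G.P l) => ∀ h : l = k, h ▸ x = c.2).card
        = ∏ l ∈ univ.erase k, G.P l := by
    refine prod_congr rfl fun l hl => ?_
    rw [filter_true_of_mem fun x _ h => absurd h (ne_of_mem_erase hl), card_univ,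
      Fintype.card_fin]
  rw [hk, hl]
  ring

theorem card_filter_key {N : ℕ} (G : Grid N) (k : Fin N) (c : Fin G.P₀ × Fin (G.P k)) :
    (univ.filter fun p : G.Proc => (p.1, p.2 k) = c).card = G.size / (G.P k * G.P₀) :=
  (Nat.div_eq_of_eq_mul_left (Nat.mul_pos c.2.pos c.1.pos) (card_filter_key_mul G k c).symm).symm

namespace Distribution

variable {S : Problem} {G : Grid S.N} (D : Distribution S G)

/-- The communication of the parallel general algorithm in terms of the block sizes. -/
theorem cost_parGen_le (bX : ℕ) (bM : Fin S.N → ℕ) (hX : ∀ p, (D.locX p).card ≤ bX)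
    (hM : ∀ k p, (D.locM k p).card ≤ bM k) :
    D.parGen.cost ≤ (G.P₀ - 1) * (2 * bX) + ∑ k, G.size / (G.P k * G.P₀) * (2 * bM k) := by
  refine Finset.sup_le fun p _ => ?_
  change totalWords p D.parGen.prog ≤ _
  simp only [parGen, totalWords_append]
  -- Here the `- 1` is kept, since it removes the tensor term when `P₀ = 1`; for the matrices it is
  -- dropped.
  have h1 : totalWords p D.gatherX ≤ (G.P₀ - 1) * (2 * bX) := by
    rw [gatherX, totalWords_onEach _ _ _ fun L hp => totalWords_allGather_of_notMem _ hp]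
    refine (totalWords_allGather_le (nodup_toList _) _ p bX fun q => by simpa using hX q).trans ?_
    rw [length_toList, card_filter_snd_eq]
  have h2 : ∀ k, totalWords p (D.gatherA k)
      ≤ G.size / (G.P k.1 * G.P₀) * (2 * bM k.1) := by
    intro k
    rw [gatherA, totalWords_onEach _ _ _ fun L hp => totalWords_allGather_of_notMem _ hp]
    refine (totalWords_allGather_le (nodup_toList _) _ p (bM k.1)
      fun q => by simpa using hM k.1 q).trans ?_
    rw [length_toList, card_filter_key]
    exact Nat.mul_le_mul_right _ (Nat.sub_le _ _)
  have h3 : totalWords p D.localMTTKRP = 0 := by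
    rw [localMTTKRP, totalWords_toList_flatMap]
    refine sum_eq_zero fun q _ => ?_
    rw [totalWords_toList_flatMap]
    exact sum_eq_zero fun o _ => totalWords_accumulate _ _ _ _
  have h4 : totalWords p D.scatterB ≤ G.size / (G.P S.n * G.P₀) * (2 * bM S.n) := by
    rw [scatterB, totalWords_onEach _ _ _ fun L hp => totalWords_reduceScatter_of_notMem _ _ hp]
    refine (totalWords_reduceScatter_le (nodup_toList _) _ _ p (bM S.n)
      fun q => by simpa using hM S.n q).trans ?_
    rw [length_toList, card_filter_key]
    exact Nat.mul_le_mul_right _ (Nat.sub_le _ _)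
  -- The summand `k = n` pays for the Reduce-Scatter, the others for the All-Gathers.
  rw [totalWords_toList_flatMap, h3, Fintype.sum_eq_add_sum_subtype_ne _ S.n]
  have h5 := sum_le_sum fun k (_ : k ∈ univ) => h2 k
  omega

end Distribution

/-! ### Existence of even distributions -/

section Even

/-- Division by `q` is injective on a residue class and maps it into `range (n ⌈/⌉ q)`. -/
theorem card_filter_mod_le (n q r : ℕ) (hq : 0 < q) :
    ((range n).filter fun i => i % q = r).card ≤ n ⌈/⌉ q := by
  rw [← card_range (n ⌈/⌉ q)]
  refine card_le_card_of_injOn (· / q) (fun i hi => ?_) fun i hi j hj h => ?_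
  · have hi := (mem_filter.1 hi).1
    have : n ≤ q * (n ⌈/⌉ q) := le_smul_ceilDiv hq
    simp only [coe_range, Set.mem_Iio]
    exact Nat.div_lt_of_lt_mul (by have := mem_range.1 hi; omega)
  · have hi := (mem_filter.1 hi).2
    have hj := (mem_filter.1 hj).2
    rw [← Nat.div_add_mod i q, ← Nat.div_add_mod j q, hi, hj]
    simp only at h
    rw [h]

theorem exists_even_part (n q : ℕ) (hq : 0 < q) :
    ∃ f : Fin n → Fin q, ∀ c, (univ.filter fun i => f i = c).card ≤ n ⌈/⌉ q := by
  refine ⟨fun i => ⟨i % q, Nat.mod_lt _ hq⟩, fun c => ?_⟩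
  refine le_trans ?_ (card_filter_mod_le n q c hq)
  refine card_le_card_of_injOn Fin.val (fun i hi => ?_) Fin.val_injective.injOn
  have := (mem_filter.1 hi).2
  exact mem_filter.2 ⟨mem_range.2 i.2, congrArg Fin.val this⟩

variable {α β κ : Type*} [DecidableEq β]

theorem exists_even_assignment_fiber (s : Finset α) (t : Finset β) (ht : t.Nonempty) :
    ∃ f : α → β, (∀ a, f a ∈ t) ∧ ∀ b, (s.filter fun a => f a = b).card ≤ s.card ⌈/⌉ t.card := by
  classical
  obtain ⟨g, hg⟩ := exists_even_part s.card t.card ht.card_pos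
  obtain ⟨b₀, hb₀⟩ := ht
  -- The value `b₀` outside `s` is arbitrary; it only keeps `f` inside `t`.
  refine ⟨fun a => if h : a ∈ s then (t.equivFin.symm (g (s.equivFin ⟨a, h⟩))).1
    else b₀, fun a => ?_, fun b => ?_⟩
  · dsimp only
    split_ifs with h
    · exact Subtype.prop _
    · exact hb₀
  · by_cases hb : b ∈ t
    · refine le_trans ?_ (hg (t.equivFin ⟨b, hb⟩))
      refine (card_le_card fun a ha => ?_).trans
        (card_image_le (f := fun i => (s.equivFin.symm i).1))
      obtain ⟨ha, hab⟩ := mem_filter.1 ha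
      simp only [dif_pos ha] at hab
      exact mem_image.2 ⟨s.equivFin ⟨a, ha⟩, by simp [← hab], by simp⟩
    · rw [filter_false_of_mem, card_empty]
      · exact Nat.zero_le _
      · intro a ha
        simp only [dif_pos ha]
        rintro rfl
        exact hb (Subtype.prop _)

/-- The elements of each class of `keyA` can be assigned evenly to the elements of the
corresponding class of `keyB`. -/
theorem exists_even_assignment [Fintype α] [Fintype β] [DecidableEq κ] (keyA : α → κ) (keyB : β → κ) (hB : Function.Surjective keyB) :
    ∃ f : α → β, (∀ a, keyB (f a) = keyA a) ∧ ∀ b, (univ.filter fun a => f a = b).card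
      ≤ (univ.filter fun a => keyA a = keyB b).card
        ⌈/⌉ (univ.filter fun b' => keyB b' = keyB b).card := by
  have := fun c => exists_even_assignment_fiber (univ.filter fun a => keyA a = c)
    (univ.filter fun b => keyB b = c) (let ⟨b, hb⟩ := hB c; ⟨b, by simpa using hb⟩)
  choose f h1 h2 using this
  have hf : ∀ a, keyB (f (keyA a) a) = keyA a := fun a => (mem_filter.1 (h1 (keyA a) a)).2
  refine ⟨fun a => f (keyA a) a, hf, fun b => ?_⟩
  refine (card_le_card fun a ha => ?_).trans (h2 (keyB b) b)
  have hab := (mem_filter.1 ha).2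
  have hk : keyA a = keyB b := by rw [← hab, hf]
  rw [mem_filter, mem_filter, ← hk]
  exact ⟨⟨mem_univ _, rfl⟩, hab⟩

end Even

theorem ceilDiv_le_ceilDiv {a b q : ℕ} (hq : 0 < q) (h : a ≤ b) : a ⌈/⌉ q ≤ b ⌈/⌉ q :=
  (ceilDiv_le_iff_le_mul hq).2 (h.trans (le_smul_ceilDiv hq))

theorem exists_even_distribution (S : Problem) (G : Grid S.N) (h₀ : 0 < G.P₀)
    (h : ∀ k, 0 < G.P k) : ∃ D : Distribution S G, D.Even := by
  classical
  have hpart := fun k => exists_even_part (S.I k) (G.P k) (h k)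
  choose part part_le using hpart
  obtain ⟨col, col_le⟩ := exists_even_part S.R G.P₀ h₀
  -- Zero coordinates complete a pair `(p₀, p_k)` to a processor, so no communicator is empty.
  have : ∀ k, NeZero (G.P k) := fun k => ⟨(h k).ne'⟩
  have : NeZero G.P₀ := ⟨h₀.ne'⟩
  obtain ⟨oX, oX1, oX2⟩ := exists_even_assignment
    (fun (i : S.TensorIdx) k => part k (i k)) (fun p : G.Proc => p.2) Prod.snd_surjective
  have hM := fun k => exists_even_assignment
    (fun a : Fin (S.I k) × Fin S.R => (col a.2, part k a.1)) (fun p : G.Proc => (p.1, p.2 k))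
    (fun c => ⟨(c.1, Function.update 0 k c.2), by simp⟩)
  choose oM oM1 oM2 using hM
  refine ⟨⟨part, col, oX, fun i k => congrFun (oX1 i) k, fun k a r => oM k (a, r),
    fun k a r => congrArg Prod.snd (oM1 k (a, r)),
    fun k a r => congrArg Prod.fst (oM1 k (a, r))⟩, fun p => ⟨?_, fun k => ?_⟩⟩
  · refine (oX2 p).trans ?_
    rw [card_filter_snd_eq]
    refine ceilDiv_le_ceilDiv h₀ ?_
    refine le_trans (le_of_eq ?_) (prod_le_prod' fun k _ => part_le k (p.2 k))
    rw [← Fintype.card_piFinset]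
    congr 1
    ext i
    simp [funext_iff]
  · refine (oM2 k p).trans ?_
    rw [card_filter_key]
    have hpos : 0 < G.size / (G.P k * G.P₀) := by
      rw [← card_filter_key G k (p.1, p.2 k)]
      exact card_pos.2 ⟨p, by simp⟩
    refine ceilDiv_le_ceilDiv hpos ?_
    refine le_trans (le_of_eq ?_) (Nat.mul_le_mul (part_le k (p.2 k)) (col_le p.1))
    rw [← card_product]
    congr 1
    ext a
    simp [and_comm]

/-! ### The access inequality -/

section Geometry

variable {S : Problem}

theorem card_le_prod_card_image {ι : Type*} [Fintype ι] [DecidableEq ι] {κ : ι → Type*}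
    [∀ k, DecidableEq (κ k)] (T : Finset (∀ k, κ k)) :
    T.card ≤ ∏ k, (T.image fun i => i k).card := by
  rw [← Fintype.card_piFinset]
  exact card_le_card fun i hi => Fintype.mem_piFinset.2 fun k => mem_image_of_mem _ hi

/-- The Hölder–Brascamp–Lieb bound on the number of products that can be formed from given
numbers of entries of the tensor and of the matrices. -/
theorem card_le_access (hN : 1 ≤ S.N) (F : Finset S.Iter) :
    (F.card : ℝ) ≤ ((F.image Prod.fst).card : ℝ) ^ (1 - 1 / S.N : ℝ) *
      ((∑ k, ((F.image fun z => (z.1 k, z.2)).card : ℝ)) / S.N) := by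
  have hN' : (0 : ℝ) < S.N := by exact_mod_cast hN
  have h1N : (1 : ℝ) / S.N ≤ 1 := by
    rw [div_le_one hN']
    exact_mod_cast hN
  set X := F.image Prod.fst
  let sl : Fin S.R → Finset S.TensorIdx := fun r => (F.filter fun z => z.2 = r).image Prod.fst
  have hF : F.card = ∑ r, (sl r).card := by
    rw [card_eq_sum_card_fiberwise (f := Prod.snd) (t := univ) fun _ _ => by simp]
    refine sum_congr rfl fun r _ => (card_image_of_injOn fun z hz w hw h => ?_).symm
    exact Prod.ext h ((mem_filter.1 hz).2.trans (mem_filter.1 hw).2.symm)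
  have hM : ∀ k, (F.image fun z => (z.1 k, z.2)).card
      = ∑ r, ((sl r).image fun i => i k).card := by
    intro k
    rw [card_eq_sum_card_fiberwise (f := Prod.snd) (t := univ) fun _ _ => by simp]
    refine sum_congr rfl fun r _ => ?_
    have : ((F.image fun z => (z.1 k, z.2)).filter fun a => a.2 = r)
        = ((sl r).image fun i => i k).image fun a => (a, r) := by
      ext ⟨a, r'⟩
      simp only [sl, mem_filter, mem_image, Prod.mk.injEq]
      constructor
      · rintro ⟨⟨z, hz, rfl, rfl⟩, rfl⟩
        exact ⟨z.1 k, ⟨z.1, ⟨z, ⟨hz, rfl⟩, rfl⟩, rfl⟩, rfl, rfl⟩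
      · rintro ⟨_, ⟨_, ⟨z, ⟨hz, rfl⟩, rfl⟩, rfl⟩, rfl, rfl⟩
        exact ⟨⟨z, hz, rfl, rfl⟩, rfl⟩
    rw [this, card_image_of_injective _ fun a b h => congrArg Prod.fst h]
  -- A slice of fixed column is bounded both by `X` and by the product of its projections.
  -- Interpolating with exponents `1 - 1/N` and `1/N` and applying the inequality of the means gives
  -- a bound linear in the projections, which can be summed over `r`.
  have slice : ∀ r, ((sl r).card : ℝ) ≤ (X.card : ℝ) ^ (1 - 1 / S.N : ℝ) *
      ∑ k, 1 / (S.N : ℝ) * (((sl r).image fun i => i k).card : ℝ) := by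
    intro r
    have hX : ((sl r).card : ℝ) ≤ X.card := by
      exact_mod_cast card_le_card (image_subset_image (filter_subset _ _))
    have hP : ((sl r).card : ℝ) ≤ ∏ k, (((sl r).image fun i => i k).card : ℝ) := by
      exact_mod_cast card_le_prod_card_image (sl r)
    have h0 : (0 : ℝ) ≤ (sl r).card := by positivity
    calc ((sl r).card : ℝ)
        = ((sl r).card : ℝ) ^ (1 - 1 / S.N : ℝ) * ((sl r).card : ℝ) ^ (1 / S.N : ℝ) := by
          rw [← Real.rpow_add_of_nonneg h0 (by linarith) (by positivity), sub_add_cancel,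
            Real.rpow_one]
      _ ≤ (X.card : ℝ) ^ (1 - 1 / S.N : ℝ) *
          (∏ k, (((sl r).image fun i => i k).card : ℝ)) ^ (1 / S.N : ℝ) := by
          gcongr
      _ ≤ _ := by
          rw [← Real.finsetProd_rpow _ _ fun k _ => by positivity]
          gcongr
          refine Real.geom_mean_le_arith_mean_weighted _ _ _ (fun k _ => by positivity) ?_
            fun k _ => by positivity
          simp [hN'.ne']
  calc (F.card : ℝ) = ∑ r, ((sl r).card : ℝ) := by exact_mod_cast hF
    _ ≤ ∑ r, (X.card : ℝ) ^ (1 - 1 / S.N : ℝ) *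
        ∑ k, 1 / (S.N : ℝ) * (((sl r).image fun i => i k).card : ℝ) :=
        sum_le_sum fun r _ => slice r
    _ = _ := by
        rw [← mul_sum, sum_comm, sum_div]
        congr 1
        refine sum_congr rfl fun k _ => ?_
        rw [← mul_sum, hM k]
        push_cast
        ring

end Geometry

/-! ### Where values come from -/

section Provenance

variable {S : Problem} {Proc : Type}

/-- As memories only grow, all operands ever used are in the final memory, so accesses can be
counted there. -/
theorem Legal.enabled {σ : State S Proc} {l : List (Instr S Proc)} (h : Legal σ l)
    {c : Instr S Proc} (hc : c ∈ l) : c.Enabled (run σ l) := by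
  induction l generalizing σ with
  | nil => simp at hc
  | cons d l ih =>
    rcases List.mem_cons.1 hc with rfl | hc
    · exact h.1.mono (le_run σ (c :: l))
    · exact ih h.2 hc

theorem mem_run {σ : State S Proc} {l : List (Instr S Proc)} {p : Proc} {v : Value S}
    (h : v ∈ run σ l p) : v ∈ σ p ∨ ∃ c ∈ l, c.dst = p ∧ c.result = v := by
  induction l generalizing σ with
  | nil => exact Or.inl h
  | cons d l ih =>
    rcases ih h with (h | ⟨rfl, rfl⟩) | ⟨c, hc, h⟩
    · exact Or.inl h
    · exact Or.inr ⟨d, by simp, rfl, rfl⟩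
    · exact Or.inr ⟨c, by simp [hc], h⟩

/-- Arithmetic produces only sums, so an input entry is present from the start or received. -/
theorem tensor_mem_run {σ : State S Proc} {l : List (Instr S Proc)} {p : Proc}
    {i : S.TensorIdx} (h : .tensor i ∈ run σ l p) :
    .tensor i ∈ σ p ∨ ∃ q, .comm q p (.tensor i) ∈ l := by
  refine (mem_run h).imp_right ?_
  rintro ⟨c, hc, rfl, hv⟩
  cases c with
  | comm q p v => exact ⟨q, by cases hv; exact hc⟩
  | _ => cases hv

theorem factor_mem_run {σ : State S Proc} {l : List (Instr S Proc)} {p : Proc}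
    {a : S.FactorIdx} (h : .factor a ∈ run σ l p) :
    .factor a ∈ σ p ∨ ∃ q, .comm q p (.factor a) ∈ l := by
  refine (mem_run h).imp_right ?_
  rintro ⟨c, hc, rfl, hv⟩
  cases c with
  | comm q p v => exact ⟨q, by cases hv; exact hc⟩
  | _ => cases hv

/-- `p` sends a sum of products that contains `x` and contributes to the output entry `o` only. -/
def Forwards (l : List (Instr S Proc)) (p : Proc) (o : S.OutIdx) (x : S.Iter) : Prop :=
  ∃ q m, Instr.comm p q (.psum m) ∈ l ∧ x ∈ m ∧ ∀ y ∈ m, S.target y = o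

/-- Each product in a sum has been evaluated by the processor that holds the sum, or by one that
has sent it on. -/
theorem exists_mul_of_mem_psum {σ : State S Proc} (hσ : ∀ p m, .psum m ∈ σ p → m = 0)
    {l : List (Instr S Proc)} (hl : Legal σ l) {q : Proc} {m : Multiset S.Iter} {o : S.OutIdx}
    (hm : .psum m ∈ run σ l q) (ho : ∀ y ∈ m, S.target y = o) {x : S.Iter} (hx : x ∈ m) :
    ∃ p, .mul p x.1 x.2 ∈ l ∧ (p = q ∨ Forwards l p o x) := by
  induction l using List.reverseRecOn generalizing q m with
  | nil =>
    rw [hσ q m hm] at hx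
    simp at hx
  | append_singleton l c ih =>
    rw [legal_append] at hl
    rw [run_append] at hm
    have lift : ∀ {q m}, Value.psum m ∈ run σ l q → (∀ y ∈ m, S.target y = o) → x ∈ m →
        ∃ p, .mul p x.1 x.2 ∈ l ++ [c] ∧ (p = q ∨ Forwards (l ++ [c]) p o x) := by
      intro q m hm ho hx
      obtain ⟨p, h1, h2⟩ := ih hl.1 hm ho hx
      refine ⟨p, List.mem_append_left _ h1, h2.imp_right ?_⟩
      rintro ⟨q, m, h, h'⟩
      exact ⟨q, m, List.mem_append_left _ h, h'⟩
    rcases hm with hm | ⟨rfl, hv⟩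
    · exact lift hm ho hx
    · cases c with
      | mul p i r =>
        cases hv
        rw [Multiset.mem_singleton] at hx
        subst hx
        exact ⟨p, by simp, Or.inl rfl⟩
      -- Sums never cancel, so each operand of a sum belonging to `o` alone also belongs to `o`
      -- alone.
      | add p a b =>
        cases hv
        rcases Multiset.mem_add.1 hx with hx | hx
        · exact lift hl.2.1.1 (fun y hy => ho y (Multiset.mem_add.2 (Or.inl hy))) hx
        · exact lift hl.2.1.2 (fun y hy => ho y (Multiset.mem_add.2 (Or.inr hy))) hx
      | comm s q v =>
        cases hv
        obtain ⟨p, h1, h2⟩ := lift hl.2.1 ho hx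
        refine ⟨p, h1, Or.inr ?_⟩
        -- Either the sender evaluated `x`, and this message is the required forwarding, or the
        -- evaluating processor forwarded it earlier.
        rcases h2 with rfl | h2
        · exact ⟨q, m, by simp, hx, ho⟩
        · exact h2

namespace ParAlg

variable (A : ParAlg S Proc)

open Classical in
/-- The products that `p` evaluates and passes on towards an output entry. -/
def useful (p : Proc) : Finset S.Iter :=
  univ.filter fun x => .mul p x.1 x.2 ∈ A.prog ∧
    (S.target x ∈ A.finalB p ∨ Forwards A.prog p (S.target x) x)

variable {A}

theorem IsMTTKRP.exists_useful (hA : A.IsMTTKRP) (x : S.Iter) : ∃ p, x ∈ A.useful p := by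
  classical
  obtain ⟨hl, hown, hfin⟩ := hA
  obtain ⟨q, hq⟩ := hown (S.target x)
  have hσ : ∀ p m, .psum m ∈ A.initState p → m = 0 := by
    rintro p m (⟨i, _, h⟩ | ⟨a, _, h⟩ | h) <;> cases h
    rfl
  obtain ⟨p, h1, h2⟩ := exists_mul_of_mem_psum hσ hl (hfin q _ hq)
    (fun y hy => (mem_filter.1 hy).2) (x := x) (by simp [Problem.terms])
  refine ⟨p, mem_filter.2 ⟨mem_univ _, h1, h2.imp_left ?_⟩⟩
  rintro rfl
  exact hq

/-- Pigeonhole over a cover of the iteration space; products may be evaluated repeatedly, so it need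
not be a partition. -/
theorem IsMTTKRP.exists_card_le_useful [Fintype Proc] [Nonempty Proc] (hA : A.IsMTTKRP) :
    ∃ p, S.size * S.R ≤ Fintype.card Proc * (A.useful p).card := by
  classical
  have hcard : S.size * S.R ≤ ∑ p, (A.useful p).card := by
    calc S.size * S.R = (univ : Finset S.Iter).card := by
          simp [Problem.size]
      _ ≤ (univ.biUnion A.useful).card := card_le_card fun x _ => by
          obtain ⟨p, hp⟩ := hA.exists_useful x
          exact mem_biUnion.2 ⟨p, mem_univ _, hp⟩
      _ ≤ _ := card_biUnion_le
  obtain ⟨p, -, hp⟩ := exists_le_of_sum_le (s := univ) (f := fun _ : Proc => S.size * S.R)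
    (g := fun p => Fintype.card Proc * (A.useful p).card) univ_nonempty (by
      rw [sum_const, smul_eq_mul, ← mul_sum]
      exact Nat.mul_le_mul_left _ hcard)
  exact ⟨p, hp⟩

end ParAlg

end Provenance

/-! ### Accessed entries are owned or communicated -/

section Traffic

variable {S : Problem} {Proc : Type} [DecidableEq Proc]

/-- The values received by `p`. -/
def received (p : Proc) (l : List (Instr S Proc)) : List (Value S) :=
  l.filterMap fun
    | .comm _ q v => if q = p then some v else none
    | _ => none

/-- The values sent by `p`. -/
def sent (p : Proc) (l : List (Instr S Proc)) : List (Value S) :=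
  l.filterMap fun
    | .comm q _ v => if q = p then some v else none
    | _ => none

theorem length_sent_add_length_received (p : Proc) (l : List (Instr S Proc)) :
    (sent p l).length + (received p l).length = totalWords p l := by
  induction l with
  | nil => rfl
  | cons c l ih =>
    rw [totalWords, List.map_cons, List.sum_cons, ← totalWords, ← ih]
    cases c with
    | comm q r v =>
      by_cases h1 : q = p <;> by_cases h2 : r = p <;>
        simp [sent, received, Instr.words, h1, h2] <;> omega
    | _ => simp [sent, received, Instr.words]

theorem mem_received {p q : Proc} {l : List (Instr S Proc)} {v : Value S}
    (h : .comm q p v ∈ l) : v ∈ received p l :=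
  List.mem_filterMap.2 ⟨_, h, by simp⟩

theorem mem_sent {p q : Proc} {l : List (Instr S Proc)} {v : Value S}
    (h : .comm p q v ∈ l) : v ∈ sent p l :=
  List.mem_filterMap.2 ⟨_, h, by simp⟩

/-- The partial map `f` decodes a message as the one entry it accounts for, so each message accounts
for at most one entry outside `t`. -/
theorem card_le_add_length {α β : Type*} (s t : Finset α) (l : List β) (f : β → Option α)
    (h : ∀ a ∈ s, a ∈ t ∨ ∃ b ∈ l, f b = some a) : s.card ≤ t.card + l.length := by
  classical
  calc s.card ≤ (t ∪ (l.filterMap f).toFinset).card := card_le_card fun a ha => by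
        rw [mem_union, List.mem_toFinset, List.mem_filterMap]
        exact h a ha
    _ ≤ t.card + (l.filterMap f).toFinset.card := card_union_le _ _
    _ ≤ t.card + l.length := Nat.add_le_add_left
        ((List.toFinset_card_le _).trans (List.length_filterMap_le _ _)) _

namespace ParAlg

variable (A : ParAlg S Proc)

theorem totalWords_le_cost [Fintype Proc] (p : Proc) : totalWords p A.prog ≤ A.cost :=
  Finset.le_sup (f := fun p => (A.prog.map (Instr.words p)).sum) (mem_univ p)

variable {A}

theorem IsMTTKRP.card_useful_tensor_le [Fintype Proc] (hA : A.IsMTTKRP) (p : Proc) :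
    ((A.useful p).image Prod.fst).card ≤ (A.initX p).card + A.cost := by
  classical
  refine (card_le_add_length _ (A.initX p) (received p A.prog)
    (fun v => match v with | .tensor i => some i | _ => none) fun i hi => ?_).trans
    (Nat.add_le_add_left ?_ _)
  · obtain ⟨x, hx, rfl⟩ := mem_image.1 hi
    have h := (hA.1.enabled (mem_filter.1 hx).2.1).1
    rcases tensor_mem_run h with (⟨j, hj, h⟩ | ⟨a, _, h⟩ | h) | ⟨q, hq⟩
    · cases h
      exact Or.inl hj
    · cases h
    · cases h
    · exact Or.inr ⟨_, mem_received hq, rfl⟩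
  · have := length_sent_add_length_received p A.prog
    have := A.totalWords_le_cost p
    omega

theorem IsMTTKRP.card_useful_factor_le (hA : A.IsMTTKRP) (p : Proc) :
    (univ.sigma fun k : {k : Fin S.N // k ≠ S.n} =>
      (A.useful p).image fun z => (z.1 k.1, z.2)).card
        ≤ (A.initA p).card + (received p A.prog).length := by
  classical
  refine card_le_add_length _ (A.initA p) (received p A.prog)
    (fun v => match v with | .factor a => some a | _ => none) fun a ha => ?_
  obtain ⟨k, a⟩ := a
  obtain ⟨x, hx, hxa⟩ := mem_image.1 (mem_sigma.1 ha).2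
  have h := (hA.1.enabled (mem_filter.1 hx).2.1).2 k
  simp only at hxa
  rw [hxa] at h
  rcases factor_mem_run h with (⟨j, hj, h⟩ | ⟨a, hi, h⟩ | h) | ⟨q, hq⟩
  · cases h
  · cases h
    exact Or.inl hi
  · cases h
  · exact Or.inr ⟨_, mem_received hq, rfl⟩

/-- A sent sum is decoded as the common target of its terms. Requiring a term makes this target
unique, so the choice returns the intended entry. -/
theorem card_useful_target_le (p : Proc) :
    ((A.useful p).image fun z => (z.1 S.n, z.2)).card
      ≤ (A.finalB p).card + (sent p A.prog).length := by
  classical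
  refine card_le_add_length _ (A.finalB p) (sent p A.prog)
    (fun v => match v with
      | .psum m => if h : ∃ o, (∃ x, x ∈ m) ∧ ∀ y ∈ m, S.target y = o then some h.choose else none
      | _ => none) fun o ho => ?_
  obtain ⟨x, hx, rfl⟩ := mem_image.1 ho
  refine (mem_filter.1 hx).2.2.imp_right ?_
  rintro ⟨q, m, hq, hxm, hm⟩
  refine ⟨_, mem_sent hq, ?_⟩
  have h : ∃ o, (∃ x, x ∈ m) ∧ ∀ y ∈ m, S.target y = o := ⟨_, ⟨x, hxm⟩, hm⟩
  simp only [dif_pos h, Option.some.injEq]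
  exact (h.choose_spec.2 x hxm).symm

/-- Input entries are charged to receives and output entries to sends, so together they use the cost
only once. -/
theorem IsMTTKRP.sum_card_useful_le [Fintype Proc] (hA : A.IsMTTKRP) (p : Proc) :
    ∑ k, ((A.useful p).image fun z => (z.1 k, z.2)).card
      ≤ (A.initA p).card + (A.finalB p).card + A.cost := by
  have h1 := hA.card_useful_factor_le p
  have h2 := card_useful_target_le (A := A) p
  have h3 := length_sent_add_length_received p A.prog
  have h4 := A.totalWords_le_cost p
  rw [card_sigma] at h1
  rw [Fintype.sum_eq_add_sum_subtype_ne _ S.n]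
  omega

/-- A parallel MTTKRP algorithm with a balanced distribution has a processor that accesses `x`
tensor entries and `M` matrix entries, enough to evaluate its share of the products. -/
theorem IsMTTKRP.exists_access [Fintype Proc] [Nonempty Proc] (hN : 1 ≤ S.N) (hA : A.IsMTTKRP) {γ δ : ℝ}
    (hbal : A.LoadBalanced γ δ) : ∃ x M : ℝ, 0 ≤ x ∧ 0 ≤ M ∧
      x ≤ γ * S.size / Fintype.card Proc + A.cost ∧
      M ≤ δ * S.factorSize / Fintype.card Proc + A.cost ∧
      S.N * S.size * S.R / Fintype.card Proc ≤ x ^ (1 - 1 / S.N : ℝ) * M := by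
  obtain ⟨p, hp⟩ := hA.exists_card_le_useful
  have hP : (0 : ℝ) < Fintype.card Proc := by exact_mod_cast Fintype.card_pos
  have hN' : (0 : ℝ) < S.N := by exact_mod_cast hN
  have h1 : (((A.useful p).image Prod.fst).card : ℝ) ≤ (A.initX p).card + A.cost := by
    exact_mod_cast hA.card_useful_tensor_le p
  have h2 : ∑ k, (((A.useful p).image fun z => (z.1 k, z.2)).card : ℝ)
      ≤ (A.initA p).card + (A.finalB p).card + A.cost := by
    exact_mod_cast hA.sum_card_useful_le p
  have h3 := card_le_access hN (A.useful p)
  have h4 : (S.size * S.R : ℝ) ≤ Fintype.card Proc * (A.useful p).card := by exact_mod_cast hp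
  obtain ⟨b1, b2⟩ := hbal p
  refine ⟨((A.useful p).image Prod.fst).card,
    ∑ k, (((A.useful p).image fun z => (z.1 k, z.2)).card : ℝ), Nat.cast_nonneg _,
    sum_nonneg fun k _ => Nat.cast_nonneg _, by linarith, by linarith, ?_⟩
  rw [div_le_iff₀ hP]
  rw [← mul_div_assoc, le_div_iff₀ hN'] at h3
  calc S.N * S.size * S.R = S.N * (S.size * S.R : ℝ) := by ring
    _ ≤ S.N * (Fintype.card Proc * (A.useful p).card) := by gcongr
    _ = Fintype.card Proc * ((A.useful p).card * S.N) := by ring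
    _ ≤ _ := by
      rw [mul_comm _ (Fintype.card Proc : ℝ)]
      exact mul_le_mul_of_nonneg_left h3 hP.le

end ParAlg

end Traffic

/-! ### Rounding and block sizes -/

section Rounding

theorem cast_ceilDiv_le (a b : ℕ) (hb : 0 < b) : ((a ⌈/⌉ b : ℕ) : ℝ) ≤ a / b + 1 := by
  have hb' : (0 : ℝ) < b := by exact_mod_cast hb
  rw [Nat.ceilDiv_eq_add_pred_div]
  refine Nat.cast_div_le.trans ?_
  rw [div_le_iff₀ hb', add_mul, div_mul_cancel₀ _ hb'.ne', one_mul]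
  exact_mod_cast Nat.sub_le _ _

/-- Rounding up changes a large quotient by a constant factor only. -/
theorem cast_ceilDiv_le_mul {a b : ℕ} {c : ℝ} (hb : 0 < b) (h : (b : ℝ) ≤ (c - 1) * a) :
    ((a ⌈/⌉ b : ℕ) : ℝ) ≤ c * (a / b) := by
  have hb' : (0 : ℝ) < b := by exact_mod_cast hb
  refine (cast_ceilDiv_le a b hb).trans ?_
  rw [← mul_div_assoc, div_add_one hb'.ne']
  gcongr
  linarith

end Rounding

section Fits

variable {S : Problem} {G : Grid S.N} {α β γ δ : ℝ}

theorem Fits.size_pos (h : Fits S G α β γ δ) : 0 < G.size :=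
  Nat.mul_pos h.1 (prod_pos fun k _ => (h.2.2.2 k).1)

theorem Fits.R_pos (h : Fits S G α β γ δ) : 0 < S.R := by
  by_contra h'
  have h1 := h.2.1
  have h0 : (0 : ℝ) < G.P₀ := by exact_mod_cast h.1
  rw [Nat.eq_zero_of_not_pos h'] at h1
  simp at h1
  linarith [h.1]

theorem Fits.I_pos (h : Fits S G α β γ δ) (k : Fin S.N) : 0 < S.I k := by
  by_contra h'
  have h1 := (h.2.2.2 k).2.1
  have h0 : (0 : ℝ) < G.P k := by exact_mod_cast (h.2.2.2 k).1
  rw [Nat.eq_zero_of_not_pos h'] at h1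
  simp at h1
  linarith [(h.2.2.2 k).1]

theorem Fits.problem_size_pos (h : Fits S G α β γ δ) : 0 < S.size :=
  prod_pos fun k _ => h.I_pos k

theorem cast_grid_size (G : Grid S.N) : (G.size : ℝ) = G.P₀ * ∏ k, (G.P k : ℝ) := by
  simp [Grid.size]

/-- Rounding in each of the `N` modes loses a factor `α ^ (1/N)`, together `α`. The last rounding
adds at most `1`, which `P ≤ (γ - α) I` absorbs. -/
theorem Fits.tensor_block_le (hN : 1 ≤ S.N) (hα : 1 < α) (h : Fits S G α β γ δ) :
    (((∏ k, (S.I k ⌈/⌉ G.P k)) ⌈/⌉ G.P₀ : ℕ) : ℝ) ≤ γ * S.size / G.size := by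
  have hP : (0 : ℝ) < G.size := by exact_mod_cast h.size_pos
  have h0 : (0 : ℝ) < G.P₀ := by exact_mod_cast h.1
  have hprod : ((∏ k, (S.I k ⌈/⌉ G.P k) : ℕ) : ℝ) ≤ α * ∏ k, ((S.I k : ℝ) / G.P k) := by
    calc ((∏ k, (S.I k ⌈/⌉ G.P k) : ℕ) : ℝ)
        ≤ ∏ k, α ^ (1 / S.N : ℝ) * ((S.I k : ℝ) / G.P k) := by
          push_cast
          exact prod_le_prod (fun k _ => Nat.cast_nonneg _) fun k _ =>
            cast_ceilDiv_le_mul (h.2.2.2 k).1 (h.2.2.2 k).2.1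
      _ = _ := by
          rw [prod_mul_distrib, prod_const, card_univ, Fintype.card_fin, one_div,
            Real.rpow_inv_natCast_pow (by linarith) (by omega)]
  calc _ ≤ ((∏ k, (S.I k ⌈/⌉ G.P k) : ℕ) : ℝ) / G.P₀ + 1 := cast_ceilDiv_le _ _ h.1
    _ ≤ α * (∏ k, ((S.I k : ℝ) / G.P k)) / G.P₀ + 1 := by gcongr
    _ = α * S.size / G.size + 1 := by
        rw [prod_div_distrib, cast_grid_size, Problem.size]
        push_cast
        rw [mul_div_assoc', div_div, mul_comm (G.P₀ : ℝ)]
    _ ≤ _ := by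
        rw [div_add_one hP.ne']
        gcongr
        linarith [h.2.2.1]

/-- Rows lose a factor `α ^ (1/N)` and columns a factor `β`; the gap between `δ` and `α ^ (1/N) * β`
absorbs the last rounding. -/
theorem Fits.matrix_block_le (hα : 1 < α) (hβ : 1 < β) (h : Fits S G α β γ δ) (k : Fin S.N) :
    ((((S.I k ⌈/⌉ G.P k) * (S.R ⌈/⌉ G.P₀)) ⌈/⌉ (G.size / (G.P k * G.P₀)) : ℕ) : ℝ)
      ≤ δ * (S.I k * S.R) / G.size := by
  have hP : (0 : ℝ) < G.size := by exact_mod_cast h.size_pos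
  have h0 : (0 : ℝ) < G.P₀ := by exact_mod_cast h.1
  have hk : (0 : ℝ) < G.P k := by exact_mod_cast (h.2.2.2 k).1
  have hα' : 0 < α ^ (1 / S.N : ℝ) := by positivity
  -- The communicator size shows that the natural-number quotient `q` is exact.
  have hmul := card_filter_key_mul G k (⟨0, h.1⟩, ⟨0, (h.2.2.2 k).1⟩)
  rw [card_filter_key] at hmul
  set q := G.size / (G.P k * G.P₀)
  have hq : 0 < q := Nat.pos_of_ne_zero fun hq => by
    rw [hq, zero_mul] at hmul
    exact h.size_pos.ne hmul
  have hq' : (0 : ℝ) < q := by exact_mod_cast hq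
  have hmul' : (q * (G.P k * G.P₀) : ℝ) = G.size := by exact_mod_cast hmul
  calc _ ≤ (((S.I k ⌈/⌉ G.P k) * (S.R ⌈/⌉ G.P₀) : ℕ) : ℝ) / q + 1 := cast_ceilDiv_le _ _ hq
    _ ≤ (α ^ (1 / S.N : ℝ) * (S.I k / G.P k)) * (β * (S.R / G.P₀)) / q + 1 := by
        push_cast
        have h1 := cast_ceilDiv_le_mul (h.2.2.2 k).1 (h.2.2.2 k).2.1
        have h2 := cast_ceilDiv_le_mul h.1 h.2.1
        gcongr
    _ = α ^ (1 / S.N : ℝ) * β * (S.I k * S.R) / G.size + 1 := by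
        rw [← hmul']
        field_simp
    _ ≤ _ := by
        rw [div_add_one hP.ne']
        gcongr
        linarith [(h.2.2.2 k).2.2]

theorem cast_factorSize (S : Problem) : (S.factorSize : ℝ) = (∑ k, (S.I k : ℝ)) * S.R := by
  rw [Problem.factorSize]
  push_cast
  rw [sum_mul]

theorem Fits.parGen_loadBalanced (hN : 1 ≤ S.N) (hα : 1 < α) (hβ : 1 < β)
    (h : Fits S G α β γ δ) {D : Distribution S G} (hD : D.Even) :
    D.parGen.LoadBalanced γ δ := by
  intro p
  rw [card_grid_proc]
  refine ⟨?_, ?_⟩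
  · exact le_trans (by exact_mod_cast (hD p).1) (h.tensor_block_le hN hα)
  · have hcard : (D.parGen.initA p).card + (D.parGen.finalB p).card
        = ∑ k, (D.locM k p).card := by
      rw [Fintype.sum_eq_add_sum_subtype_ne _ S.n, add_comm]
      simp only [Distribution.parGen, card_sigma]
    have : ∀ k, ((D.locM k p).card : ℝ) ≤ δ * (S.I k * S.R) / G.size := fun k =>
      le_trans (by exact_mod_cast (hD p).2 k) (h.matrix_block_le hα hβ k)
    calc ((D.parGen.initA p).card + (D.parGen.finalB p).card : ℝ)
        = ∑ k, ((D.locM k p).card : ℝ) := by exact_mod_cast hcard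
      _ ≤ ∑ k, δ * (S.I k * S.R) / (G.size : ℝ) := sum_le_sum fun k _ => this k
      _ = _ := by
        rw [Problem.factorSize]
        push_cast
        rw [mul_sum, sum_div]

theorem Fits.cost_parGen_le (hN : 1 ≤ S.N) (hα : 1 < α) (hβ : 1 < β)
    (h : Fits S G α β γ δ) {D : Distribution S G} (hD : D.Even) :
    (D.parGen.cost : ℝ) ≤ (G.P₀ - 1) * (2 * (γ * (S.size / G.size)))
      + 2 * S.R * ∑ k, δ * (S.I k / G.P k) / G.P₀ := by
  have hP : (0 : ℝ) < G.size := by exact_mod_cast h.size_pos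
  have h0 : (0 : ℝ) < G.P₀ := by exact_mod_cast h.1
  have h1 : (1 : ℝ) ≤ G.P₀ := by exact_mod_cast h.1
  have hcost : (D.parGen.cost : ℝ) ≤ _ := Nat.cast_le.2
    (D.cost_parGen_le _ _ (fun p => (hD p).1) fun k p => (hD p).2 k)
  refine hcost.trans ?_
  push_cast [Nat.cast_sub (show 1 ≤ G.P₀ from h.1)]
  rw [mul_sum]
  refine add_le_add ?_ (sum_le_sum fun k _ => ?_)
  · have := h.tensor_block_le hN hα
    rw [mul_div_assoc] at this
    exact mul_le_mul_of_nonneg_left (mul_le_mul_of_nonneg_left this zero_le_two)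
      (by linarith)
  · have hk : (0 : ℝ) < G.P k := by exact_mod_cast (h.2.2.2 k).1
    calc _ ≤ (G.size / (G.P k * G.P₀) : ℝ) * (2 * (δ * (S.I k * S.R) / G.size)) := by
          have h2 := h.matrix_block_le hα hβ k
          have h3 : ((G.size / (G.P k * G.P₀) : ℕ) : ℝ) ≤ G.size / (G.P k * G.P₀) := by
            exact_mod_cast Nat.cast_div_le (α := ℝ) (m := G.size) (n := G.P k * G.P₀)
          gcongr
      _ = _ := by field_simp

/-- Optimality follows from matching bounds on the two sides of a quantity `K`. -/
theorem Fits.commOptimal (hN : 1 ≤ S.N) (hα : 1 < α) (hβ : 1 < β) (h : Fits S G α β γ δ)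
    {C lb K : ℝ} (hU : ∀ D : Distribution S G, D.Even → (D.parGen.cost : ℝ) ≤ K)
    (hlb : K ≤ C * lb) (hA : ∀ A : ParAlg S (Fin G.size), A.IsMTTKRP → A.LoadBalanced γ δ →
      K ≤ C * A.cost) : CommOptimal S G γ δ C lb :=
  ⟨exists_even_distribution S G h.1 fun k => (h.2.2.2 k).1, fun D hD =>
    ⟨D.parGen_isMTTKRP, h.parGen_loadBalanced hN hα hβ hD, (hU D hD).trans hlb,
      fun A h1 h2 => (hU D hD).trans (hA A h1 h2)⟩⟩

end Fits

/-! ### Lower bounds on communication -/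

section LowerBounds

variable {S : Problem} {P : ℕ} {γ δ : ℝ}

/-- The memory-independent lower bound that is strong for few columns. -/
theorem lbStationary_le_cost (hN : 2 ≤ S.N) (hP : 0 < P) (hI : 0 < S.size) (hγ : 0 < γ)
    {A : ParAlg S (Fin P)} (hA : A.IsMTTKRP) (hbal : A.LoadBalanced γ δ) :
    lbStationary S P γ δ ≤ A.cost := by
  have : Nonempty (Fin P) := ⟨⟨0, hP⟩⟩
  obtain ⟨x, M, hx0, hM0, hx, hM, hxM⟩ := hA.exists_access (by omega) hbal
  rw [Fintype.card_fin] at hx hM hxM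
  have hP' : (0 : ℝ) < P := by exact_mod_cast hP
  have hI' : (0 : ℝ) < S.size := by exact_mod_cast hI
  have hn : (2 : ℝ) ≤ S.N := by exact_mod_cast hN
  have he : 1 / (S.N : ℝ) ≤ 1 := by
    rw [div_le_one (by linarith)]
    linarith
  rw [mul_div_assoc] at hx
  have hu : (0 : ℝ) < S.size / P := by positivity
  have hR : (S.N * S.size * S.R / P : ℝ) = S.N * S.R * (S.size / P) := by ring
  rw [hR] at hxM
  have h2 : γ * S.size / (2 * P) = γ / 2 * (S.size / P) := by
    field_simp
  rw [lbStationary, h2]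
  set u : ℝ := S.size / P
  set e : ℝ := 1 / S.N
  -- Above this threshold at least `γ u / 2` tensor entries are not owned. Below it, the access
  -- inequality forces `M` to be large, with the constant `(3γ/2)^(-(1 - 1/N))`.
  rcases le_total x (3 * γ / 2 * u) with hle | hle
  · refine (min_le_left _ _).trans ?_
    have hsplit : u = u ^ (1 - e) * u ^ e := by
      rw [← Real.rpow_add hu, sub_add_cancel, Real.rpow_one]
    have hg : (0 : ℝ) < 3 * γ / 2 := by positivity
    have hmul : (S.N * S.R * u ^ e) * u ^ (1 - e) ≤ ((3 * γ / 2) ^ (1 - e) * M) * u ^ (1 - e) := by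
      calc (S.N * S.R * u ^ e) * u ^ (1 - e) = S.N * S.R * u := by
            conv_rhs => rw [hsplit]
            ring
        _ ≤ (3 * γ / 2 * u) ^ (1 - e) * M :=
            hxM.trans (by gcongr)
        _ = _ := by
            rw [Real.mul_rpow hg.le hu.le]
            ring
    have h1 := le_of_mul_le_mul_right hmul (by positivity)
    have hinv : (2 / (3 * γ)) ^ (1 - e) * (3 * γ / 2) ^ (1 - e) = 1 := by
      rw [← Real.mul_rpow (by positivity) hg.le]
      rw [show 2 / (3 * γ) * (3 * γ / 2) = 1 by field_simp, Real.one_rpow]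
    have h3 : (2 / (3 * γ)) ^ (1 - e) * (S.N * S.R * u ^ e) ≤ M := by
      calc _ ≤ (2 / (3 * γ)) ^ (1 - e) * ((3 * γ / 2) ^ (1 - e) * M) := by gcongr
        _ = M := by rw [← mul_assoc, hinv, one_mul]
    rw [mul_assoc]
    linarith
  · refine (min_le_right _ _).trans ?_
    linarith

/-- A weighted form of the inequality of the means. -/
theorem two_mul_le_add_of_rpow_le {n K x M : ℝ} (hn : 1 ≤ n) (hK : 0 < K) (hx : K ≤ x)
    (hM : 0 ≤ M) (h : K ^ (2 - 1 / n) ≤ x ^ (1 - 1 / n) * M) : 2 * K ≤ x + M := by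
  have hx0 : 0 < x := hK.trans_le hx
  -- The assumption `K ≤ x` trades the missing factor `K ^ (1/n)` for `x ^ (1/n)`. It is needed: the
  -- unconstrained minimum of `x + M` can lie below `2K`.
  have h1 : K ^ 2 ≤ x * M := by
    calc K ^ 2 = K ^ (2 - 1 / n) * K ^ (1 / n) := by
          rw [← Real.rpow_add hK, sub_add_cancel]
          norm_cast
      _ ≤ (x ^ (1 - 1 / n) * M) * x ^ (1 / n) := by gcongr
      _ = x ^ (1 - 1 / n) * x ^ (1 / n) * M := by ring
      _ = x * M := by rw [← Real.rpow_add hx0, sub_add_cancel, Real.rpow_one]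
  nlinarith [sq_nonneg (x - M)]

/-- If a processor cannot own the operands of its share of the products, then it communicates. -/
theorem le_cost_of_many_columns (hN : 2 ≤ S.N) (hP : 0 < P) {A : ParAlg S (Fin P)}
    (hA : A.IsMTTKRP) (hbal : A.LoadBalanced γ δ) {K τ : ℝ} (hK : 0 < K) (hγ : 1 < γ)
    (hvol : K ^ (2 - 1 / S.N : ℝ) = S.N * S.size * S.R / P)
    (hX : (S.size : ℝ) / P ≤ K) (hM : δ * S.factorSize / P ≤ (2 - (γ + τ)) * K) :
    τ * K ≤ 2 * A.cost := by
  have : Nonempty (Fin P) := ⟨⟨0, hP⟩⟩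
  obtain ⟨x, M, hx0, hM0, hx, hM', hxM⟩ := hA.exists_access (by omega) hbal
  rw [Fintype.card_fin] at hx hM' hxM
  have hn : (2 : ℝ) ≤ S.N := by exact_mod_cast hN
  have he : 1 / (S.N : ℝ) ≤ 1 := by
    rw [div_le_one (by linarith)]
    linarith
  have hc : (0 : ℝ) ≤ A.cost := Nat.cast_nonneg _
  have hx' : x ≤ γ * K + A.cost := by
    rw [mul_div_assoc] at hx
    have : γ * (S.size / P : ℝ) ≤ γ * K := by gcongr
    linarith
  -- The actual `x` may be below `K`, so its upper bound `γ K + cost`, which is at least `K` by `1 <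
  -- γ`, takes its place. The cost then occurs once through `x` and once through `M`.
  have := two_mul_le_add_of_rpow_le (n := S.N) (K := K) (x := γ * K + A.cost) (M := M)
    (by linarith) hK (by nlinarith) hM0 (by
      rw [hvol]
      refine hxM.trans ?_
      gcongr)
  nlinarith

end LowerBounds

/-! ### Exponent identities -/

section Exponents

/-- With `N R` and `I / P` as `a`, `b` in either order, this turns the upper and the lower condition
on `P₀` into bounds by multiples of `K = (a b)^(n/(2n-1))`. -/
theorem rpow_balance {n a b : ℝ} (hn : 1 ≤ n) (ha : 0 < a) (hb : 0 < b) :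
    (a ^ n / b ^ (n - 1)) ^ (1 / (2 * n - 1)) * b = (a * b) ^ (n / (2 * n - 1)) := by
  have hn0 : n ≠ 0 := by linarith
  have hd : n * 2 - 1 ≠ 0 := by linarith
  have hd' : 2 * n - 1 ≠ 0 := by linarith
  rw [Real.div_rpow (by positivity) (by positivity), ← Real.rpow_mul ha.le,
    ← Real.rpow_mul hb.le, Real.mul_rpow ha.le hb.le, mul_one_div, mul_one_div, div_mul_eq_mul_div,
    mul_div_assoc]
  congr 1
  conv_lhs => rw [← Real.rpow_one b, ← Real.rpow_mul hb.le, one_mul, ← Real.rpow_sub hb]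
  congr 1
  field_simp
  ring

/-- This is the regime condition rewritten as `I / P < K`. -/
theorem lt_rpow_of_rpow_lt {n u v : ℝ} (hn : 1 ≤ n) (hu : 0 < u) (h : u ^ (1 - 1 / n) < v) :
    u < (v * u) ^ (n / (2 * n - 1)) := by
  have hn0 : n ≠ 0 := by linarith
  have hd : 0 < 2 * n - 1 := by linarith
  have hd' : n * 2 - 1 ≠ 0 := by linarith
  calc u = (u ^ (1 - 1 / n) * u) ^ (n / (2 * n - 1)) := by
        conv_rhs => rw [← Real.rpow_add_one hu.ne', ← Real.rpow_mul hu.le]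
        conv_lhs => rw [← Real.rpow_one u]
        congr 1
        field_simp
        ring
    _ < _ := by
        refine Real.rpow_lt_rpow (by positivity) ?_ (by positivity)
        gcongr

theorem rpow_volume {n z : ℝ} (hn : 1 ≤ n) (hz : 0 < z) :
    (z ^ (n / (2 * n - 1))) ^ (2 - 1 / n) = z := by
  have hn0 : n ≠ 0 := by linarith
  have hd : n * 2 - 1 ≠ 0 := by linarith
  have hd' : 2 * n - 1 ≠ 0 := by linarith
  rw [← Real.rpow_mul hz.le]
  conv_rhs => rw [← Real.rpow_one z]
  congr 1
  field_simp

end Exponents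

/-! ### Optimality in the two regimes -/

section Regimes

variable {S : Problem} {G : Grid S.N} {α β γ δ : ℝ}

/-- Everything is compared with `N R u^(1/N)`, `u = I / P`: the algorithm costs at most `2ε` times
this, and the lower bound is at least `min η (1/2)` times this. -/
theorem commOptimal_of_few_columns {ε η : ℝ} (hε : 0 < ε) (hη : 0 < η) (hN : 2 ≤ S.N)
    (hα : 1 < α) (hβ : 1 < β) (hγ : α < γ) (hδ : α ^ (1 / S.N : ℝ) * β < δ)
    (h : Fits S G α β γ δ)
    (hcol : (S.N * S.R : ℝ) ≤ (S.size / G.size : ℝ) ^ (1 - 1 / S.N : ℝ)) (h₀ : G.P₀ = 1)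
    (hk : ∀ k, (S.I k / G.P k : ℝ) ≤ ε / δ * (S.size / G.size : ℝ) ^ (1 / S.N : ℝ))
    (hc : η < (2 / (3 * γ)) ^ (1 - 1 / S.N : ℝ))
    (hP : (δ / ((2 / (3 * γ)) ^ (1 - 1 / S.N : ℝ) - η)
        * ((∑ k, (S.I k : ℝ)) / (S.N * (S.size : ℝ) ^ (1 / S.N : ℝ))))
      ^ ((S.N : ℝ) / (S.N - 1)) ≤ G.size) :
    CommOptimal S G γ δ (2 * ε / min η (1 / 2)) (lbStationary S G.size γ δ) := by
  have hn : (2 : ℝ) ≤ S.N := by exact_mod_cast hN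
  have hI : (0 : ℝ) < S.size := by exact_mod_cast h.problem_size_pos
  have hR : (0 : ℝ) < S.R := by exact_mod_cast h.R_pos
  have hp : (0 : ℝ) < G.size := by exact_mod_cast h.size_pos
  have hδ0 : 0 < δ := lt_trans (by positivity) hδ
  have hγ0 : 0 < γ := by linarith
  have hu : (0 : ℝ) < S.size / G.size := by positivity
  have hm : 0 < min η (1 / 2) := lt_min hη (by norm_num)
  set u : ℝ := S.size / G.size with hu_def
  set c : ℝ := (2 / (3 * γ)) ^ (1 - 1 / S.N : ℝ)
  have hsplit : u ^ (1 - 1 / S.N : ℝ) * u ^ (1 / S.N : ℝ) = u := by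
    rw [← Real.rpow_add hu, sub_add_cancel, Real.rpow_one]
  have ht : 0 < u ^ (1 / S.N : ℝ) := by positivity
  -- This is the condition on `P`, solved for the owned matrix share; it leaves the fraction `η` in
  -- the first argument of the minimum.
  have hfac : δ * S.factorSize / G.size ≤ (c - η) * (S.N * S.R * u ^ (1 / S.N : ℝ)) := by
    have hs : 0 ≤ ∑ k, (S.I k : ℝ) := sum_nonneg fun k _ => Nat.cast_nonneg _
    have hcη : 0 < c - η := by linarith
    have hinv : (S.N : ℝ) / (S.N - 1) = (1 - 1 / S.N : ℝ)⁻¹ := by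
      rw [one_sub_div (by linarith), inv_div]
    have hpos : 0 < (1 - 1 / S.N : ℝ) := by
      rw [sub_pos, div_lt_one (by linarith)]
      linarith
    rw [hinv, Real.rpow_inv_le_iff_of_pos (by positivity) hp.le hpos] at hP
    have hpow : (G.size : ℝ) ^ (1 - 1 / S.N : ℝ) * (G.size : ℝ) ^ (1 / S.N : ℝ) = G.size := by
      rw [← Real.rpow_add hp, sub_add_cancel, Real.rpow_one]
    rw [div_mul_div_comm, div_le_iff₀ (by positivity)] at hP
    rw [cast_factorSize, div_le_iff₀ hp]
    calc δ * ((∑ k, (S.I k : ℝ)) * S.R) = δ * (∑ k, (S.I k : ℝ)) * S.R := by ring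
      _ ≤ (G.size : ℝ) ^ (1 - 1 / S.N : ℝ) * ((c - η) * (S.N * (S.size : ℝ) ^ (1 / S.N : ℝ)))
          * S.R := by gcongr
      _ = _ := by
        rw [hu_def, Real.div_rpow hI.le hp.le]
        rw [eq_div_of_mul_eq (by positivity) hpow]
        ring
  have hlb : min η (1 / 2) * (S.N * S.R * u ^ (1 / S.N : ℝ)) ≤ lbStationary S G.size γ δ := by
    refine le_min ?_ ?_
    · calc _ ≤ η * (S.N * S.R * u ^ (1 / S.N : ℝ)) := by
            gcongr
            exact min_le_left _ _
        _ ≤ _ := by linarith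
    -- The second argument is large enough because few columns mean `N R u^(1/N) ≤ u`, and `γ > 1`.
    · calc _ ≤ 1 / 2 * (S.N * S.R * u ^ (1 / S.N : ℝ)) := by
            gcongr
            exact min_le_right _ _
        _ ≤ 1 / 2 * (u ^ (1 - 1 / S.N : ℝ) * u ^ (1 / S.N : ℝ)) := by gcongr
        _ = 1 / 2 * u := by rw [hsplit]
        _ ≤ γ / 2 * u := by
            gcongr
            linarith
        _ = _ := by
            rw [hu_def]
            field_simp
  have hK : 2 * ε * (S.N * S.R * u ^ (1 / S.N : ℝ))
      ≤ 2 * ε / min η (1 / 2) * lbStationary S G.size γ δ := by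
    rw [div_mul_eq_mul_div, le_div_iff₀ hm]
    calc _ = 2 * ε * (min η (1 / 2) * (S.N * S.R * u ^ (1 / S.N : ℝ))) := by ring
      _ ≤ _ := by gcongr
  refine h.commOptimal (by omega) hα hβ (fun D hD => ?_) hK fun A hA hbal => hK.trans ?_
  · refine (h.cost_parGen_le (by omega) hα hβ hD).trans ?_
    rw [h₀, Nat.cast_one, sub_self, zero_mul, zero_add]
    calc _ ≤ 2 * S.R * ∑ k : Fin S.N, ε * u ^ (1 / S.N : ℝ) := by
          gcongr with k
          rw [div_one]
          calc δ * (S.I k / G.P k : ℝ) ≤ δ * (ε / δ * u ^ (1 / S.N : ℝ)) := by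
                gcongr
                exact hk k
            _ = _ := by field_simp
      _ = _ := by
          rw [sum_const, card_univ, Fintype.card_fin, nsmul_eq_mul]
          ring
  · have := lbStationary_le_cost hN h.size_pos h.problem_size_pos hγ0 hA hbal
    gcongr

/-- The algorithm costs at most `2(μ + ν)K`, whereas `τ K` is at most `lbGeneral` and at most twice
the cost of any competitor; this factor two makes the constant `4(μ + ν)/τ`. -/
theorem commOptimal_of_many_columns {μ ν τ : ℝ} (hμ : 0 < μ) (hν : 0 < ν) (hτ : 0 < τ)
    (hN : 2 ≤ S.N) (hα : 1 < α) (hβ : 1 < β) (hγ : α < γ) (hδ : α ^ (1 / S.N : ℝ) * β < δ)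
    (h : Fits S G α β γ δ)
    (hcol : (S.size / G.size : ℝ) ^ (1 - 1 / S.N : ℝ) < (S.N * S.R : ℝ))
    (hk : ∀ k, δ / ν * ((S.N * S.R : ℝ) ^ ((S.N : ℝ) - 1) / (S.size / G.size : ℝ) ^ (S.N : ℝ))
      ^ (1 / (2 * S.N - 1) : ℝ) * (S.I k / G.P k) ≤ G.P₀)
    (h₀ : (G.P₀ : ℝ) ≤ μ / γ * ((S.N * S.R : ℝ) ^ (S.N : ℝ)
      / (S.size / G.size : ℝ) ^ ((S.N : ℝ) - 1)) ^ (1 / (2 * S.N - 1) : ℝ))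
    (hτγ : τ < 2 - γ)
    (hP : (δ / (2 - (γ + τ)) * ∑ k, (S.I k : ℝ)) ^ ((2 * S.N - 1 : ℝ) / (S.N - 1)) * S.R
      / (S.N * S.size : ℝ) ^ ((S.N : ℝ) / (S.N - 1)) ≤ G.size) :
    CommOptimal S G γ δ (4 * (μ + ν) / τ) (lbGeneral S G.size γ δ) := by
  have hn : (2 : ℝ) ≤ S.N := by exact_mod_cast hN
  have hI : (0 : ℝ) < S.size := by exact_mod_cast h.problem_size_pos
  have hR : (0 : ℝ) < S.R := by exact_mod_cast h.R_pos
  have hp : (0 : ℝ) < G.size := by exact_mod_cast h.size_pos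
  have hp₀ : (0 : ℝ) < G.P₀ := by exact_mod_cast h.1
  have hδ0 : 0 < δ := lt_trans (by positivity) hδ
  have hγ0 : 0 < γ := by linarith
  have hu : (0 : ℝ) < S.size / G.size := by positivity
  have hv : (0 : ℝ) < S.N * S.R := by positivity
  have hvol : (S.N * S.size * S.R / G.size : ℝ) = S.N * S.R * (S.size / G.size) := by ring
  have hz : (0 : ℝ) < S.N * S.size * S.R / G.size := by positivity
  have hbal₁ := rpow_balance (n := S.N) (by linarith) hv hu
  have hbal₂ := rpow_balance (n := S.N) (by linarith) hu hv
  have huK := lt_rpow_of_rpow_lt (n := S.N) (by linarith) hu hcol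
  have hKvol := rpow_volume (n := S.N) (by linarith) hz
  rw [mul_comm (S.size / G.size : ℝ)] at hbal₂
  rw [← hvol] at hbal₁ hbal₂ huK
  -- This is the condition on `P` after taking the `(N-1)/(2N-1)`-th power and restoring the factor
  -- `R / P`.
  have hfac : δ * S.factorSize / G.size
      ≤ (2 - (γ + τ)) * (S.N * S.size * S.R / G.size : ℝ) ^ ((S.N : ℝ) / (2 * S.N - 1)) := by
    have hs : 0 ≤ ∑ k, (S.I k : ℝ) := sum_nonneg fun k _ => Nat.cast_nonneg _
    have hc : 0 < 2 - (γ + τ) := by linarith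
    have hn1 : (0 : ℝ) < S.N - 1 := by linarith
    have hd : (0 : ℝ) < 2 * S.N - 1 := by linarith
    have hw : (0 : ℝ) < S.R / G.size := by positivity
    have hNI : (0 : ℝ) < S.N * S.size := by positivity
    rw [div_le_iff₀ (by positivity), ← le_div_iff₀ hR, ← inv_div (S.N - 1 : ℝ),
      Real.rpow_inv_le_iff_of_pos (by positivity) (by positivity) (by positivity),
      div_mul_eq_mul_div, div_le_iff₀ hc] at hP
    have hexp : (G.size * (S.N * S.size : ℝ) ^ ((S.N : ℝ) / (S.N - 1)) / S.R)
          ^ ((S.N - 1 : ℝ) / (2 * S.N - 1)) * (S.R / G.size)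
        = (S.N * S.size * S.R / G.size : ℝ) ^ ((S.N : ℝ) / (2 * S.N - 1)) := by
      have e1 : (G.size * (S.N * S.size : ℝ) ^ ((S.N : ℝ) / (S.N - 1)) / S.R)
          = (S.N * S.size : ℝ) ^ ((S.N : ℝ) / (S.N - 1)) * (S.R / G.size : ℝ) ^ (-1 : ℝ) := by
        rw [Real.rpow_neg_one, inv_div]
        ring
      rw [e1, Real.mul_rpow (by positivity) (by positivity), ← Real.rpow_mul hNI.le,
        ← Real.rpow_mul hw.le, mul_assoc, ← Real.rpow_add_one hw.ne', mul_div_assoc (_ * _ : ℝ),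
        Real.mul_rpow hNI.le hw.le]
      congr 2
      · field_simp
      · rw [eq_div_iff hd.ne', add_mul, mul_assoc, div_mul_cancel₀ _ hd.ne']
        ring
    rw [cast_factorSize, ← hexp]
    calc δ * ((∑ k, (S.I k : ℝ)) * S.R) / G.size
        = δ * (∑ k, (S.I k : ℝ)) * (S.R / G.size) := by ring
      _ ≤ _ * (2 - (γ + τ)) * (S.R / G.size) := by gcongr
      _ = _ := by ring
  have hlb : lbGeneral S G.size γ δ
      = 2 * (S.N * S.size * S.R / G.size : ℝ) ^ ((S.N : ℝ) / (2 * S.N - 1))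
        - γ * (S.size / G.size) - δ * S.factorSize / G.size := by
    rw [lbGeneral, mul_div_assoc γ]
  have hlow : ∀ A : ParAlg S (Fin G.size), A.IsMTTKRP → A.LoadBalanced γ δ →
      τ * (S.N * S.size * S.R / G.size : ℝ) ^ ((S.N : ℝ) / (2 * S.N - 1)) ≤ 2 * A.cost :=
    fun A hA hbal => le_cost_of_many_columns hN h.size_pos hA hbal (by positivity)
      (by linarith) hKvol huK.le hfac
  set K : ℝ := (S.N * S.size * S.R / G.size : ℝ) ^ ((S.N : ℝ) / (2 * S.N - 1))
  have hK : 0 < K := hu.trans huK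
  have hlb' : τ * K ≤ lbGeneral S G.size γ δ := by
    have : γ * (S.size / G.size : ℝ) ≤ γ * K := by gcongr
    rw [hlb]
    linarith
  refine h.commOptimal (by omega) hα hβ (K := 2 * (μ + ν) * K) (fun D hD => ?_) ?_
    fun A hA hbal => ?_
  · refine (h.cost_parGen_le (by omega) hα hβ hD).trans ?_
    have hX : (G.P₀ - 1 : ℝ) * (2 * (γ * (S.size / G.size))) ≤ 2 * μ * K := by
      calc (G.P₀ - 1 : ℝ) * (2 * (γ * (S.size / G.size)))
          ≤ G.P₀ * (2 * (γ * (S.size / G.size))) := by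
            gcongr
            linarith
        _ ≤ (μ / γ * ((S.N * S.R : ℝ) ^ (S.N : ℝ) / (S.size / G.size : ℝ) ^ ((S.N : ℝ) - 1))
              ^ (1 / (2 * S.N - 1) : ℝ)) * (2 * (γ * (S.size / G.size))) := by gcongr
        _ = _ := by
            rw [← hbal₁]
            field_simp
    have hM : ∀ k, δ * (S.I k / G.P k : ℝ) / G.P₀ * (S.N * S.R) ≤ ν * K := by
      intro k
      have hq : (S.N * S.R : ℝ) ^ ((S.N : ℝ) - 1) / (S.size / G.size : ℝ) ^ (S.N : ℝ)
          = ((S.size / G.size : ℝ) ^ (S.N : ℝ) / (S.N * S.R : ℝ) ^ ((S.N : ℝ) - 1))⁻¹ := by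
        rw [inv_div]
      have hk' := hk k
      rw [hq, Real.inv_rpow (by positivity)] at hk'
      rw [← hbal₂, ← mul_assoc ν]
      refine mul_le_mul_of_nonneg_right ?_ hv.le
      set y := ((S.size / G.size : ℝ) ^ (S.N : ℝ) / (S.N * S.R : ℝ) ^ ((S.N : ℝ) - 1))
        ^ (1 / (2 * S.N - 1) : ℝ)
      have hy : 0 < y := by positivity
      rw [div_le_iff₀ hp₀]
      calc δ * (S.I k / G.P k : ℝ) = ν * y * (δ / ν * y⁻¹ * (S.I k / G.P k)) := by field_simp
        _ ≤ ν * y * G.P₀ := by gcongr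
    have hsum : 2 * S.R * ∑ k, δ * (S.I k / G.P k : ℝ) / G.P₀ ≤ 2 * ν * K := by
      have := sum_le_sum fun k (_ : k ∈ (univ : Finset (Fin S.N))) => hM k
      rw [← sum_mul, sum_const, card_univ, Fintype.card_fin, nsmul_eq_mul] at this
      -- Each of the `N` modes contributes at most `ν K / N` after multiplication by `R`; the factor
      -- `N` in `hM` cancels the number of summands.
      refine le_of_mul_le_mul_left ?_ (show (0 : ℝ) < S.N by linarith)
      linarith
    linarith
  · calc 2 * (μ + ν) * K = 2 * (μ + ν) / τ * (τ * K) := by field_simp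
      _ ≤ 4 * (μ + ν) / τ * lbGeneral S G.size γ δ := by
          gcongr
          norm_num
  · calc 2 * (μ + ν) * K = 2 * (μ + ν) / τ * (τ * K) := by field_simp
      _ ≤ 2 * (μ + ν) / τ * (2 * A.cost) := by
          have := hlow A hA hbal
          gcongr
      _ = _ := by ring

end Regimes

end MTTKRP

end

theorem theorem5 :
    -- few columns: `N R ≤ (I / P) ^ (1 - 1 / N)`
    (∀ ε η : ℝ, 0 < ε → 0 < η → ∃ C : ℝ, 0 < C ∧
      ∀ (S : MTTKRP.Problem) (G : MTTKRP.Grid S.N) (α β γ δ : ℝ), 2 ≤ S.N →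
        1 < α → 1 < β → α < γ → α ^ (1 / S.N : ℝ) * β < δ →
        MTTKRP.Fits S G α β γ δ →
        (S.N * S.R : ℝ) ≤ (S.size / G.size : ℝ) ^ (1 - 1 / S.N : ℝ) →
        G.P₀ = 1 →
        (∀ k, (S.I k / G.P k : ℝ) ≤ ε / δ * (S.size / G.size : ℝ) ^ (1 / S.N : ℝ)) →
        η < (2 / (3 * γ)) ^ (1 - 1 / S.N : ℝ) →
        (δ / ((2 / (3 * γ)) ^ (1 - 1 / S.N : ℝ) - η)
            * ((∑ k, (S.I k : ℝ)) / (S.N * (S.size : ℝ) ^ (1 / S.N : ℝ))))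
          ^ ((S.N : ℝ) / (S.N - 1)) ≤ G.size →
        MTTKRP.CommOptimal S G γ δ C (MTTKRP.lbStationary S G.size γ δ)) ∧
    -- many columns: `N R > (I / P) ^ (1 - 1 / N)`
    (∀ μ ν τ : ℝ, 0 < μ → 0 < ν → 0 < τ → ∃ C : ℝ, 0 < C ∧
      ∀ (S : MTTKRP.Problem) (G : MTTKRP.Grid S.N) (α β γ δ : ℝ), 2 ≤ S.N →
        1 < α → 1 < β → α < γ → α ^ (1 / S.N : ℝ) * β < δ →
        MTTKRP.Fits S G α β γ δ →
        (S.size / G.size : ℝ) ^ (1 - 1 / S.N : ℝ) < (S.N * S.R : ℝ) →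
        (∀ k, δ / ν * ((S.N * S.R : ℝ) ^ ((S.N : ℝ) - 1) / (S.size / G.size : ℝ) ^ (S.N : ℝ))
              ^ (1 / (2 * S.N - 1) : ℝ) * (S.I k / G.P k) ≤ G.P₀) →
        (G.P₀ : ℝ) ≤ μ / γ * ((S.N * S.R : ℝ) ^ (S.N : ℝ)
              / (S.size / G.size : ℝ) ^ ((S.N : ℝ) - 1)) ^ (1 / (2 * S.N - 1) : ℝ) →
        τ < 2 - γ →
        (δ / (2 - (γ + τ)) * ∑ k, (S.I k : ℝ)) ^ ((2 * S.N - 1 : ℝ) / (S.N - 1)) * S.R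
            / (S.N * S.size : ℝ) ^ ((S.N : ℝ) / (S.N - 1)) ≤ G.size →
        MTTKRP.CommOptimal S G γ δ C (MTTKRP.lbGeneral S G.size γ δ)) := by
  refine ⟨fun ε η hε hη => ⟨2 * ε / min η (1 / 2), by positivity, ?_⟩,
    fun μ ν τ hμ hν hτ => ⟨4 * (μ + ν) / τ, by positivity, ?_⟩⟩
  · intro S G α β γ δ hN hα hβ hγ hδ h hcol h₀ hk hc hP
    exact MTTKRP.commOptimal_of_few_columns hε hη hN hα hβ hγ hδ h hcol h₀ hk hc hP
  · intro S G α β γ δ hN hα hβ hγ hδ h hcol hk h₀ hτγ hP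
    exact MTTKRP.commOptimal_of_many_columns hμ hν hτ hN hα hβ hγ hδ h hcol hk h₀ hτγ hP
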